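/- Let $X$ be an alphabet and $P$ a set of cells $(u\to v)$, where $u,v$ are words in $X$. Consider the diagrams (plane directed labelled graphs, up to planar isotopy) built from trivial diagrams $\varepsilon(w)$ and the cells in $P$ by addition $\Delta_0+\Delta_1$ (placing side by side), multiplication $\Delta_0\circ\Delta_1$ (gluing the bottom path of $\Delta_0$ to the equally labelled top path of $\Delta_1$), and inversion (flipping upside down). A dipole is a pair of mutually inverse cells, the bottom path of the first being the top path of the second; eliminating it means deleting both cells and identifying the top path of the first with the bottom path of the second. A diagram is reduced if it has no dipoles, and two diagrams are equivalent if they are related by the equivalence relation generated by eliminating dipoles. The diagram group $D(P,w)$ consists of the equivalence classes of diagrams whose top and bottom paths are both labelled by $w$, with the multiplication induced by $\circ$; Thompson's group is $F=D(\{x^2\to x\},x)$. A length function on a group $G$ is a map $l:G\to\mathbb{R}$ with $l(g)\ge 0$, $l(1)=0$, $l(g^{-1})=l(g)$ and $l(gh)\le l(g)+l(h)$ for all $g,h\in G$. It is universally monotone if for every $r\in\mathbb{R}$ there is $K\in\mathbb{N}=\{0,1,2,\dots\}$ such that $l(g^{K})\ge l(g)+r$ for all $g\in G\setminus\{1\}$.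 Claim. Every element $g$ of $F$ is represented by exactly one reduced diagram (up to isotopy); let $l(g)$ be its number of cells. Then $l$ is a length function on $F$, and $l$ is not universally monotone. Moreover, for every integer $n>1$ there is a reduced diagram $\Delta\in F$ such that $l(\Delta^n)<l(\Delta)$. -/

import Mathlib

/-- A length function on a group: nonnegative, zero at the identity, symmetric, subadditive. -/
structure IsLengthFunction {G : Type*} [Group G] (l : G → ℝ) : Prop where
  nonneg : ∀ g, 0 ≤ l g
  map_one : l 1 = 0
  map_inv : ∀ g, l g⁻¹ = l g
  map_mul_le : ∀ g h, l (g * h) ≤ l g + l h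

/-- A function `l` on a group is universally monotone if for each real `r` there is a natural
number `K` such that `l (g ^ K) ≥ l g + r` for every `g ≠ 1`. -/
def UniversallyMonotone {G : Type*} [Group G] (l : G → ℝ) : Prop :=
  ∀ r : ℝ, ∃ K : ℕ, ∀ g : G, g ≠ 1 → l g + r ≤ l (g ^ K)

namespace DiagramGroup

/-- Expressions for diagrams over an alphabet `X`: trivial diagrams `ε(w)`, cells `(u → v)`,
sums `Δ₀ + Δ₁` (side by side) and products `Δ₀ ∘ Δ₁` (the first one on top). -/
inductive Expr (X : Type*) : Type _
  | triv (w : List X) : Expr X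
  | cell (u v : List X) : Expr X
  | add (d e : Expr X) : Expr X
  | comp (d e : Expr X) : Expr X

namespace Expr

variable {X : Type*}

/-- The label of the top path. -/
def top : Expr X → List X
  | triv w => w
  | cell u _ => u
  | add d e => d.top ++ e.top
  | comp d _ => d.top

/-- The label of the bottom path. -/
def bot : Expr X → List X
  | triv w => w
  | cell _ v => v
  | add d e => d.bot ++ e.bot
  | comp _ e => e.bot

/-- The inverse: the diagram flipped about a horizontal line. The cell `(u → v)` becomes
the cell `(v → u)`, which is its inverse. -/
def inv : Expr X → Expr X
  | triv w => triv w
  | cell u v => cell v u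
  | add d e => add d.inv e.inv
  | comp d e => comp e.inv d.inv

/-- The number of cells. -/
def cells : Expr X → ℕ
  | triv _ => 0
  | cell _ _ => 1
  | add d e => d.cells + e.cells
  | comp d e => d.cells + e.cells

/-- The expression denotes a diagram built from trivial diagrams, cells in `P` and inverses of
cells in `P`: in every product `Δ₀ ∘ Δ₁` the bottom label of `Δ₀` is the top label of `Δ₁`. -/
def IsDiagram (P : Set (List X × List X)) : Expr X → Prop
  | triv _ => True
  | cell u v => (u, v) ∈ P ∨ (v, u) ∈ P
  | add d e => d.IsDiagram P ∧ e.IsDiagram P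
  | comp d e => d.IsDiagram P ∧ e.IsDiagram P ∧ d.bot = e.top

/-- Planar isotopy. Two expressions draw the same picture up to planar isotopy when they are
identified by the laws of a strict monoidal category: `+` and `∘` are associative, trivial
diagrams are neutral and additive, and `+` and `∘` satisfy the interchange law (so that diagrams
up to isotopy are the morphisms of the free strict monoidal category on the cells). -/
inductive Isotopic : Expr X → Expr X → Prop
  | refl (d) : Isotopic d d
  | symm {d e} : Isotopic d e → Isotopic e d
  | trans {d e f} : Isotopic d e → Isotopic e f → Isotopic d f
  | add_congr {d d' e e'} : Isotopic d d' → Isotopic e e' → Isotopic (add d e) (add d' e')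
  | comp_congr {d d' e e'} : Isotopic d d' → Isotopic e e' → Isotopic (comp d e) (comp d' e')
  | add_assoc (d e f) : Isotopic (add (add d e) f) (add d (add e f))
  | nil_add (d) : Isotopic (add (triv []) d) d
  | add_nil (d) : Isotopic (add d (triv [])) d
  | triv_add (u v) : Isotopic (add (triv u) (triv v)) (triv (u ++ v))
  | comp_assoc (d e f) : Isotopic (comp (comp d e) f) (comp d (comp e f))
  | triv_comp (d) : Isotopic (comp (triv d.top) d) d
  | comp_triv (d) : Isotopic (comp d (triv d.bot)) d
  | interchange (d d' e e') (h : d.bot = d'.top) (h' : e.bot = e'.top) :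
      Isotopic (add (comp d d') (comp e e')) (comp (add d e) (add d' e'))

@[simp] theorem top_inv (d : Expr X) : d.inv.top = d.bot := by
  induction d <;> simp_all [inv, top, bot]

@[simp] theorem bot_inv (d : Expr X) : d.inv.bot = d.top := by
  induction d <;> simp_all [inv, top, bot]

@[simp] theorem inv_inv (d : Expr X) : d.inv.inv = d := by
  induction d <;> simp_all [inv]

@[simp] theorem cells_inv (d : Expr X) : d.inv.cells = d.cells := by
  induction d <;> simp_all [inv, cells, add_comm]

theorem isDiagram_inv {P : Set (List X × List X)} {d : Expr X} (h : d.IsDiagram P) :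
    d.inv.IsDiagram P := by
  induction d with
  | triv w => trivial
  | cell u v => exact Or.symm h
  | add d e hd he => exact ⟨hd h.1, he h.2⟩
  | comp d e hd he => exact ⟨he h.2.1, hd h.1, by simpa using h.2.2.symm⟩

theorem Isotopic.top_eq {d e : Expr X} (h : Isotopic d e) : d.top = e.top := by
  induction h <;> simp_all [top]

theorem Isotopic.bot_eq {d e : Expr X} (h : Isotopic d e) : d.bot = e.bot := by
  induction h <;> simp_all [bot]

theorem Isotopic.cells_eq {d e : Expr X} (h : Isotopic d e) : d.cells = e.cells := by
  induction h <;> simp_all [cells] <;> omega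

theorem Isotopic.isDiagram_iff {P : Set (List X × List X)} {d e : Expr X} (h : Isotopic d e) :
    d.IsDiagram P ↔ e.IsDiagram P := by
  induction h with
  | comp_congr h h' ih ih' => simp [IsDiagram, ih, ih', h.bot_eq, h'.top_eq]
  | symm _ ih => exact ih.symm
  | trans _ _ ih ih' => exact ih.trans ih'
  | interchange d d' e e' h h' => simp [IsDiagram, h, h', top, bot]; tauto
  | _ => simp_all [IsDiagram, top, bot] <;> tauto

theorem Isotopic.inv {d e : Expr X} (h : Isotopic d e) : Isotopic d.inv e.inv := by
  induction h with
  | refl d => exact .refl _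
  | symm _ ih => exact ih.symm
  | trans _ _ ih ih' => exact ih.trans ih'
  | add_congr _ _ ih ih' => exact ih.add_congr ih'
  | comp_congr _ _ ih ih' => exact ih'.comp_congr ih
  | add_assoc d e f => exact .add_assoc _ _ _
  | nil_add d => exact .nil_add _
  | add_nil d => exact .add_nil _
  | triv_add u v => exact .triv_add _ _
  | comp_assoc d e f => exact (Isotopic.comp_assoc _ _ _).symm
  | triv_comp d => simpa [Expr.inv] using Isotopic.comp_triv d.inv
  | comp_triv d => simpa [Expr.inv] using Isotopic.triv_comp d.inv
  | interchange d d' e e' h h' =>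
    exact .interchange _ _ _ _ (by simpa using h.symm) (by simpa using h'.symm)

end Expr

variable {X : Type*} (P : Set (List X × List X))

/-- Expressions over `P` with top label `u` and bottom label `v`. -/
def PreDiagram (u v : List X) : Type _ :=
  {d : Expr X // d.IsDiagram P ∧ d.top = u ∧ d.bot = v}

instance isotopySetoid (u v : List X) : Setoid (PreDiagram P u v) where
  r d e := Expr.Isotopic d.1 e.1
  iseqv := ⟨fun _ => .refl _, fun h => h.symm, fun h h' => h.trans h'⟩

/-- The `(u, v)`-diagrams over `P`, up to planar isotopy. -/
def Diagram (u v : List X) : Type _ := Quotient (isotopySetoid P u v)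

variable {P}

namespace Diagram

variable {u v w u' v' : List X}

/-- The trivial diagram `ε(w)`. -/
def triv (w : List X) : Diagram P w w := ⟦⟨.triv w, trivial, rfl, rfl⟩⟧

/-- Addition of diagrams. -/
def add : Diagram P u v → Diagram P u' v' → Diagram P (u ++ u') (v ++ v') :=
  Quotient.map₂ (fun d e => ⟨.add d.1 e.1, ⟨d.2.1, e.2.1⟩,
    congrArg₂ (· ++ ·) d.2.2.1 e.2.2.1, congrArg₂ (· ++ ·) d.2.2.2 e.2.2.2⟩)
    (fun _ _ h _ _ h' => Expr.Isotopic.add_congr h h')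

/-- Multiplication of diagrams. -/
def comp : Diagram P u v → Diagram P v w → Diagram P u w :=
  Quotient.map₂ (fun d e => ⟨.comp d.1 e.1, ⟨d.2.1, e.2.1, d.2.2.2.trans e.2.2.1.symm⟩,
    d.2.2.1, e.2.2.2⟩) (fun _ _ h _ _ h' => Expr.Isotopic.comp_congr h h')

/-- Inversion of diagrams. -/
def inv : Diagram P u v → Diagram P v u :=
  Quotient.map (fun d => ⟨d.1.inv, Expr.isDiagram_inv d.2.1,
    d.1.top_inv.trans d.2.2.2, d.1.bot_inv.trans d.2.2.1⟩) (fun _ _ h => Expr.Isotopic.inv h)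

/-- The number of cells of a diagram. -/
def cells : Diagram P u v → ℕ :=
  Quotient.lift (fun d => d.1.cells) (fun _ _ h => Expr.Isotopic.cells_eq h)

/-- The diagram `ε(p) + (a → b) ∘ (b → a) + ε(q)`: a single dipole in a trivial surrounding. -/
def dipole (p a b q : List X) (h : (a, b) ∈ P ∨ (b, a) ∈ P) (hw : w = p ++ a ++ q) :
    Diagram P w w :=
  ⟦⟨.add (.add (.triv p) (.comp (.cell a b) (.cell b a))) (.triv q),
    ⟨⟨trivial, h, h.symm, rfl⟩, trivial⟩, hw.symm, hw.symm⟩⟧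

/-- `D'` is obtained from `D` by eliminating one dipole: `D` contains a cell `(a → b)` whose
whole bottom path is the top path of an inverse cell `(b → a)`, and `D'` arises by deleting these
two cells and identifying the top of the first with the bottom of the second. (The two cells can
be drawn directly below each other, with the rest `A` of the diagram above and the rest `B` below
them.) -/
def DipoleStep (D D' : Diagram P u v) : Prop :=
  ∃ (w p a b q : List X) (h : (a, b) ∈ P ∨ (b, a) ∈ P) (hw : w = p ++ a ++ q)
    (A : Diagram P u w) (B : Diagram P w v),
    D = A.comp ((dipole p a b q h hw).comp B) ∧ D' = A.comp B

/-- A diagram is reduced if it has no dipoles. -/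
def Reduced (D : Diagram P u v) : Prop := ∀ D', ¬ DipoleStep D D'

theorem comp_assoc {x : List X} (D : Diagram P u v) (E : Diagram P v w) (F : Diagram P w x) :
    (D.comp E).comp F = D.comp (E.comp F) := by
  induction D using Quotient.inductionOn
  induction E using Quotient.inductionOn
  induction F using Quotient.inductionOn
  exact Quotient.sound (Expr.Isotopic.comp_assoc _ _ _)

theorem triv_comp (D : Diagram P u v) : (triv u).comp D = D := by
  induction D using Quotient.inductionOn with
  | h d =>
    obtain ⟨d, hd, rfl, rfl⟩ := d
    exact Quotient.sound (Expr.Isotopic.triv_comp d)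

theorem comp_triv (D : Diagram P u v) : D.comp (triv v) = D := by
  induction D using Quotient.inductionOn with
  | h d =>
    obtain ⟨d, hd, rfl, rfl⟩ := d
    exact Quotient.sound (Expr.Isotopic.comp_triv d)

theorem add_comp_add {w' : List X} (D : Diagram P u v) (D' : Diagram P u' v')
    (E : Diagram P v w) (E' : Diagram P v' w') :
    (D.add D').comp (E.add E') = (D.comp E).add (D'.comp E') := by
  induction D using Quotient.inductionOn with
  | h d => induction D' using Quotient.inductionOn with
    | h d' => induction E using Quotient.inductionOn with
      | h e => induction E' using Quotient.inductionOn with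
        | h e' =>
          exact Quotient.sound (Expr.Isotopic.interchange _ _ _ _
            (d.2.2.2.trans e.2.2.1.symm) (d'.2.2.2.trans e'.2.2.1.symm)).symm

theorem inv_comp (D : Diagram P u v) (E : Diagram P v w) :
    (D.comp E).inv = E.inv.comp D.inv := by
  induction D using Quotient.inductionOn
  induction E using Quotient.inductionOn
  rfl

theorem inv_inv (D : Diagram P u v) : D.inv.inv = D := by
  induction D using Quotient.inductionOn with
  | h d => exact congrArg (Quotient.mk _) (Subtype.ext d.1.inv_inv)

theorem inv_triv (w : List X) : (triv w : Diagram P w w).inv = triv w := rfl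

theorem inv_dipole (p a b q : List X) (h : (a, b) ∈ P ∨ (b, a) ∈ P) (hw : w = p ++ a ++ q) :
    (dipole p a b q h hw).inv = dipole p a b q h hw := rfl

theorem cells_comp (D : Diagram P u v) (E : Diagram P v w) :
    (D.comp E).cells = D.cells + E.cells := by
  induction D using Quotient.inductionOn
  induction E using Quotient.inductionOn
  rfl

theorem cells_dipole (p a b q : List X) (h : (a, b) ∈ P ∨ (b, a) ∈ P) (hw : w = p ++ a ++ q) :
    (dipole p a b q h hw).cells = 2 := rfl

theorem dipole_add_triv (p a b q s : List X) (h : (a, b) ∈ P ∨ (b, a) ∈ P)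
    (hw : w = p ++ a ++ q) :
    (dipole p a b q h hw).add (triv s) = dipole p a b (q ++ s) h (by simp [hw]) :=
  Quotient.sound ((Expr.Isotopic.add_assoc _ _ _).trans
    ((Expr.Isotopic.refl _).add_congr (.triv_add _ _)))

theorem triv_add_dipole (p a b q s : List X) (h : (a, b) ∈ P ∨ (b, a) ∈ P)
    (hw : w = p ++ a ++ q) :
    (triv s).add (dipole p a b q h hw) = dipole (s ++ p) a b q h (by simp [hw]) :=
  Quotient.sound ((Expr.Isotopic.add_assoc _ _ _).symm.trans
    (((Expr.Isotopic.add_assoc _ _ _).symm.trans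
      ((Expr.Isotopic.triv_add _ _).add_congr (.refl _))).add_congr (.refl _)))

theorem DipoleStep.comp_right {D D' : Diagram P u v} (h : DipoleStep D D')
    (E : Diagram P v w) : DipoleStep (D.comp E) (D'.comp E) := by
  obtain ⟨x, p, a, b, q, h, hw, A, B, rfl, rfl⟩ := h
  exact ⟨x, p, a, b, q, h, hw, A, B.comp E, by simp only [comp_assoc], comp_assoc _ _ _⟩

theorem DipoleStep.comp_left {D D' : Diagram P v w} (E : Diagram P u v)
    (h : DipoleStep D D') : DipoleStep (E.comp D) (E.comp D') := by
  obtain ⟨x, p, a, b, q, h, hw, A, B, rfl, rfl⟩ := h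
  exact ⟨x, p, a, b, q, h, hw, E.comp A, B, (comp_assoc _ _ _).symm, (comp_assoc _ _ _).symm⟩

theorem DipoleStep.inv {D D' : Diagram P u v} (h : DipoleStep D D') :
    DipoleStep D.inv D'.inv := by
  obtain ⟨x, p, a, b, q, h, hw, A, B, rfl, rfl⟩ := h
  exact ⟨x, p, a, b, q, h, hw, B.inv, A.inv,
    by simp only [inv_comp, inv_dipole, comp_assoc], inv_comp _ _⟩

theorem DipoleStep.add_right {D D' : Diagram P u v} (h : DipoleStep D D')
    (E : Diagram P u' v') : DipoleStep (D.add E) (D'.add E) := by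
  obtain ⟨x, p, a, b, q, h, hw, A, B, rfl, rfl⟩ := h
  refine ⟨x ++ v', p, a, b, q ++ v', h, by simp [hw], A.add E, B.add (triv v'), ?_, ?_⟩
  · rw [← dipole_add_triv p a b q v' h hw]
    simp only [add_comp_add, comp_triv]
  · simp only [add_comp_add, comp_triv]

theorem DipoleStep.add_left {D D' : Diagram P u v} (E : Diagram P u' v')
    (h : DipoleStep D D') : DipoleStep (E.add D) (E.add D') := by
  obtain ⟨x, p, a, b, q, h, hw, A, B, rfl, rfl⟩ := h
  refine ⟨v' ++ x, v' ++ p, a, b, q, h, by simp [hw], E.add A, (triv v').add B, ?_, ?_⟩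
  · rw [← triv_add_dipole p a b q v' h hw]
    simp only [add_comp_add, comp_triv]
  · simp only [add_comp_add, comp_triv]

theorem DipoleStep.cells_eq {D D' : Diagram P u v} (h : DipoleStep D D') :
    D.cells = D'.cells + 2 := by
  obtain ⟨x, p, a, b, q, h, hw, A, B, rfl, rfl⟩ := h
  simp only [cells_comp, cells_dipole]
  omega

end Diagram

variable (P) in
/-- Equivalence classes of `(u, v)`-diagrams, for the equivalence relation generated by the
elimination of dipoles. -/
def DiagramClass (u v : List X) : Type _ := Quot (Diagram.DipoleStep (P := P) (u := u) (v := v))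

namespace DiagramClass

variable {u v w u' v' : List X}

/-- The equivalence class of a diagram. -/
def mk (D : Diagram P u v) : DiagramClass P u v := Quot.mk _ D

def comp : DiagramClass P u v → DiagramClass P v w → DiagramClass P u w :=
  Quot.map₂ Diagram.comp (fun D _ _ h => h.comp_left D) (fun _ _ E h => h.comp_right E)

def add : DiagramClass P u v → DiagramClass P u' v' → DiagramClass P (u ++ u') (v ++ v') :=
  Quot.map₂ Diagram.add (fun D _ _ h => h.add_left D) (fun _ _ E h => h.add_right E)

def inv : DiagramClass P u v → DiagramClass P v u :=
  Quot.map Diagram.inv (fun _ _ h => h.inv)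

theorem comp_inv_expr (d : Expr X) (h : d.IsDiagram P) :
    ∀ (hu : d.top = u) (hv : d.bot = v),
    mk (Diagram.comp (P := P) (u := u) (v := v) (w := u) ⟦⟨d, h, hu, hv⟩⟧
      (Diagram.inv ⟦⟨d, h, hu, hv⟩⟧)) =
      mk (Diagram.triv u) := by
  induction d generalizing u v with
  | triv w =>
    rintro rfl rfl
    exact congrArg mk (Diagram.triv_comp (Diagram.triv w))
  | cell a b =>
    rintro rfl rfl
    have hs : Diagram.DipoleStep (P := P) (Diagram.dipole [] a b [] h (by simp))
        (Diagram.triv a) := by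
      refine ⟨a, [], a, b, [], h, by simp, Diagram.triv a, Diagram.triv a, ?_, ?_⟩
      · rw [Diagram.comp_triv, Diagram.triv_comp]
      · rw [Diagram.comp_triv]
    refine Eq.trans (congrArg mk (Quotient.sound ?_)) (Quot.sound hs)
    exact ((Expr.Isotopic.add_nil _).trans (Expr.Isotopic.nil_add _)).symm
  | add d e hd he =>
    rintro rfl rfl
    have h1 := hd h.1 rfl rfl
    have h2 := he h.2 rfl rfl
    have h3 := congrArg₂ add h1 h2
    refine Eq.trans (congrArg mk ?_) (h3.trans (congrArg mk ?_))
    · exact Diagram.add_comp_add (P := P) ⟦⟨d, h.1, rfl, rfl⟩⟧ ⟦⟨e, h.2, rfl, rfl⟩⟧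
        (Diagram.inv ⟦⟨d, h.1, rfl, rfl⟩⟧) (Diagram.inv ⟦⟨e, h.2, rfl, rfl⟩⟧)
    · exact Quotient.sound (Expr.Isotopic.triv_add _ _)
  | comp d e hd he =>
    rintro rfl rfl
    have h1 := hd h.1 rfl h.2.2
    have h2 := he h.2.1 rfl rfl
    let D : Diagram P d.top e.top := ⟦⟨d, h.1, rfl, h.2.2⟩⟧
    let E : Diagram P e.top e.bot := ⟦⟨e, h.2.1, rfl, rfl⟩⟧
    change mk ((D.comp E).comp (D.comp E).inv) = _
    rw [Diagram.inv_comp, Diagram.comp_assoc, ← Diagram.comp_assoc E]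
    change comp (mk D) (comp (mk (E.comp E.inv)) (mk D.inv)) = _
    rw [h2]
    change mk (D.comp ((Diagram.triv _).comp D.inv)) = _
    rw [Diagram.triv_comp]
    exact h1

theorem comp_inv (g : DiagramClass P u v) : g.comp g.inv = mk (Diagram.triv u) := by
  induction g using Quot.ind with
  | mk D => induction D using Quotient.inductionOn with
    | h d => exact comp_inv_expr d.1 d.2.1 d.2.2.1 d.2.2.2

theorem inv_inv (g : DiagramClass P u v) : g.inv.inv = g := by
  induction g using Quot.ind with
  | mk D => exact congrArg mk D.inv_inv

theorem inv_comp (g : DiagramClass P u v) : g.inv.comp g = mk (Diagram.triv v) := by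
  simpa only [inv_inv] using comp_inv g.inv

/-- Every diagram is equivalent to a reduced one. -/
theorem exists_reduced (g : DiagramClass P u v) : ∃ D : Diagram P u v, D.Reduced ∧ mk D = g := by
  induction g using Quot.ind with
  | mk D =>
    induction hn : D.cells using Nat.strong_induction_on generalizing D with
    | _ n ih =>
      by_cases hD : D.Reduced
      · exact ⟨D, hD, rfl⟩
      · simp only [Diagram.Reduced, not_forall, not_not] at hD
        obtain ⟨D', h⟩ := hD
        obtain ⟨E, hE, hE'⟩ := ih D'.cells (by have := h.cells_eq; omega) D' rfl
        exact ⟨E, hE, hE'.trans (Quot.sound h).symm⟩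

/-- The number of cells of a reduced diagram representing the given class. -/
noncomputable def cellLength (g : DiagramClass P u v) : ℝ :=
  ((Classical.choose (exists_reduced g)).cells : ℝ)

end DiagramClass

/-- The diagram group `D(P, w)`: `(w, w)`-diagrams over `P` up to equivalence, multiplied by
`∘`. -/
instance diagramGroup (w : List X) : Group (DiagramClass P w w) where
  mul := DiagramClass.comp
  one := DiagramClass.mk (Diagram.triv w)
  inv := DiagramClass.inv
  mul_assoc g h k := by
    induction g using Quot.ind
    induction h using Quot.ind
    induction k using Quot.ind
    exact congrArg DiagramClass.mk (Diagram.comp_assoc _ _ _)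
  one_mul g := by
    induction g using Quot.ind
    exact congrArg DiagramClass.mk (Diagram.triv_comp _)
  mul_one g := by
    induction g using Quot.ind
    exact congrArg DiagramClass.mk (Diagram.comp_triv _)
  inv_mul_cancel g := DiagramClass.inv_comp g

/-- The presentation with one letter `x` and one cell `(x² → x)`. -/
def thompsonCells : Set (List Unit × List Unit) := {([(), ()], [()])}

/-- The one-letter word `x`. -/
def wordX : List Unit := [()]

/-- Thompson's group `F`, as the diagram group `D({x² → x}, x)`. -/
abbrev ThompsonF : Type := DiagramClass thompsonCells wordX wordX

/-- The `(x, x)`-diagrams over `{x² → x}`. -/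
abbrev ThompsonDiagram : Type := Diagram thompsonCells wordX wordX

end DiagramGroup

/-! Let the cell (x → x²) read one letter of a point of the Cantor set and pass the rest to the left
or right edge accordingly, while the inverse cell writes the letter back. Isotopy and dipole
elimination do not change the resulting map, so F acts on the Cantor set. A diagram without dipoles
splits edges before it merges any (`hasDipole_or_isNormal`). Hence a reduced (x, x)-diagram is a
binary tree t on top of an inverted binary tree u with equally many leaves, and its map f replaces
the address of each leaf of t by the address of the corresponding leaf of u.

The central point is `mem_nodes_iff`: for a reduced pair, the internal nodes of t are exactly the
addresses v that f does not replace by another prefix. If f did so at an internal node, then u would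
contain the same subtree above the same leaves, and the two copies would produce a dipole. So f
determines t, and then u. This gives uniqueness of the reduced diagram, faithfulness of the action,
and a formula for the length: twice the number of such v (`exists_finset_not_good`).

For the powers, let a be the generator `shift`, let β have large length, and let b_j be a copy of β
acting below the address 1^(j+1)0. Then b_j is the conjugate of b_0 by a^j, and b_0 commutes with
b_n. For g = (b_0 b_n)⁻¹ a (b_0 b_n) the copies at n cancel in the power: gⁿ = aⁿ b_{2n}⁻¹ b_0, of
length at most 2 l(β) + C with C depending only on n. For n > 1, however, g itself involves β or β⁻¹
below three distinct addresses, so l(g) ≥ 3 l(β) by `sum_cellLength_le`. It remains to take l(β) >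
C. -/

namespace DiagramGroup

/-! ### Dipoles in expressions -/

namespace Expr

variable {X : Type*}

instance : Trans (Isotopic (X := X)) Isotopic Isotopic := ⟨Isotopic.trans⟩

/-- The expression visibly contains a dipole, up to isotopy. -/
inductive HasDipole : Expr X → Prop
  | cell (a b : List X) : HasDipole (comp (cell a b) (cell b a))
  | add_left {d e} : HasDipole d → HasDipole (add d e)
  | add_right {d e} : HasDipole e → HasDipole (add d e)
  | comp_left {d e} : HasDipole d → HasDipole (comp d e)
  | comp_right {d e} : HasDipole e → HasDipole (comp d e)
  | isotopic {d e} : Isotopic d e → HasDipole d → HasDipole e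

/-- The diagram denoted by an expression. -/
def toDiagram {P : Set (List X × List X)} (d : Expr X) (hd : d.IsDiagram P) {u v : List X}
    (hu : d.top = u) (hv : d.bot = v) : Diagram P u v := ⟦⟨d, hd, hu, hv⟩⟧

theorem Isotopic.toDiagram_eq {P : Set (List X × List X)} {d e : Expr X} (h : Isotopic d e)
    {hd : d.IsDiagram P} {he : e.IsDiagram P} {u v : List X}
    {hu : d.top = u} {hv : d.bot = v} {hu' : e.top = u} {hv' : e.bot = v} :
    d.toDiagram hd hu hv = e.toDiagram he hu' hv' := Quotient.sound h

/-- An expression with a dipole denotes a diagram that is not reduced. -/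
theorem HasDipole.exists_dipoleStep {P : Set (List X × List X)} {d : Expr X} (h : HasDipole d)
    (hd : d.IsDiagram P) : ∀ {u v : List X} (hu : d.top = u) (hv : d.bot = v),
    ∃ D' : Diagram P u v, Diagram.DipoleStep (d.toDiagram hd hu hv) D' := by
  induction h with
  | cell a b =>
    intro u v hu hv
    obtain rfl : a = u := hu
    obtain rfl : a = v := hv
    refine ⟨Diagram.triv a, a, [], a, b, [], hd.1, by simp, Diagram.triv a, Diagram.triv a,
      ?_, ?_⟩
    · rw [Diagram.comp_triv, Diagram.triv_comp]
      exact Quotient.sound ((Isotopic.add_nil _).trans (Isotopic.nil_add _)).symm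
    · rw [Diagram.comp_triv]
  | @add_left d e _ ih =>
    rintro _ _ rfl rfl
    obtain ⟨D', h'⟩ := ih hd.1 rfl rfl
    exact ⟨_, h'.add_right ⟦⟨e, hd.2, rfl, rfl⟩⟧⟩
  | @add_right d e _ ih =>
    rintro _ _ rfl rfl
    obtain ⟨D', h'⟩ := ih hd.2 rfl rfl
    exact ⟨_, h'.add_left ⟦⟨d, hd.1, rfl, rfl⟩⟧⟩
  | @comp_left d e _ ih =>
    rintro _ _ rfl rfl
    obtain ⟨D', h'⟩ := ih hd.1 rfl rfl
    exact ⟨_, h'.comp_right ⟦⟨e, hd.2.1, hd.2.2.symm, rfl⟩⟧⟩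
  | @comp_right d e _ ih =>
    rintro _ _ rfl rfl
    obtain ⟨D', h'⟩ := ih hd.2.1 rfl rfl
    exact ⟨_, h'.comp_left ⟦⟨d, hd.1, rfl, hd.2.2⟩⟧⟩
  | @isotopic d e hde _ ih =>
    intro u v hu hv
    have hd' := hde.isDiagram_iff.2 hd
    obtain ⟨D', h'⟩ := ih hd' (hde.top_eq.trans hu) (hde.bot_eq.trans hv)
    refine ⟨D', ?_⟩
    rwa [hde.symm.toDiagram_eq]

/-- Isolates the two inner factors, where an upper and a lower diagram meet and a dipole can arise.
-/
theorem Isotopic.comp4 (a b c d : Expr X) :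
    Isotopic (comp (comp a b) (comp c d)) (comp a (comp (comp b c) d)) :=
  (comp_assoc _ _ _).trans ((Isotopic.refl _).comp_congr (comp_assoc _ _ _).symm)

theorem Isotopic.triv_comp' {w : List X} {d : Expr X} (h : d.top = w) :
    Isotopic (comp (triv w) d) d := h ▸ triv_comp d

theorem Isotopic.comp_triv' {w : List X} {d : Expr X} (h : d.bot = w) :
    Isotopic (comp d (triv w)) d := h ▸ comp_triv d

end Expr

open DiagramGroup.Expr

/-! ### Trees, forests and the normal form of a diagram without dipoles -/

/-- With a one-letter alphabet a label is just a length, so conditions for gluing paths become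
arithmetic. -/
theorem unit_list_ext {u v : List Unit} (h : u.length = v.length) : u = v :=
  List.ext_getElem h (fun _ _ _ => rfl)

/-- Binary trees. -/
inductive Tree : Type
  | leaf : Tree
  | node (l r : Tree) : Tree

namespace Tree

/-- The number of leaves. -/
def leaves : Tree → ℕ
  | leaf => 1
  | node l r => l.leaves + r.leaves

/-- The diagram with top label `x` that subdivides edges as the tree prescribes. -/
def expr : Tree → Expr Unit
  | leaf => .triv [()]
  | node l r => .comp (.cell [()] [(), ()]) (.add l.expr r.expr)

@[simp] theorem top_expr (t : Tree) : t.expr.top = [()] := by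
  cases t <;> rfl

@[simp] theorem length_bot_expr (t : Tree) : t.expr.bot.length = t.leaves := by
  induction t <;> simp_all [expr, leaves, bot]

theorem isDiagram_expr (t : Tree) : t.expr.IsDiagram thompsonCells := by
  induction t with
  | leaf => trivial
  | node l r hl hr => exact ⟨Or.inr rfl, ⟨hl, hr⟩, by simp [bot, top]⟩

theorem leaves_eq_cells_add_one (t : Tree) : t.leaves = t.expr.cells + 1 := by
  induction t with
  | leaf => rfl
  | node l r hl hr => simp [leaves, expr, cells, hl, hr]; omega

end Tree

/-- The sum of the diagrams of the trees of a forest. -/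
def forestExpr : List Tree → Expr Unit
  | [] => .triv []
  | t :: F => .add t.expr (forestExpr F)

/-- The number of leaves of a forest. -/
def forestLeaves (F : List Tree) : ℕ := (F.map Tree.leaves).sum

@[simp] theorem forestLeaves_nil : forestLeaves [] = 0 := rfl

@[simp] theorem forestLeaves_cons (t : Tree) (F : List Tree) :
    forestLeaves (t :: F) = t.leaves + forestLeaves F := rfl

@[simp] theorem forestLeaves_append (F G : List Tree) :
    forestLeaves (F ++ G) = forestLeaves F + forestLeaves G := by
  simp [forestLeaves]

@[simp] theorem length_top_forestExpr (F : List Tree) :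
    (forestExpr F).top.length = F.length := by
  induction F with
  | nil => rfl
  | cons t F ih => simp [forestExpr, top, ih]

@[simp] theorem length_bot_forestExpr (F : List Tree) :
    (forestExpr F).bot.length = forestLeaves F := by
  induction F with
  | nil => rfl
  | cons t F ih => simp [forestExpr, bot, ih]

theorem forestExpr_append (F G : List Tree) :
    Isotopic (forestExpr (F ++ G)) (.add (forestExpr F) (forestExpr G)) := by
  induction F with
  | nil => exact (Isotopic.nil_add _).symm
  | cons t F ih =>
    exact ((Isotopic.refl _).add_congr ih).trans (Isotopic.add_assoc _ _ _).symm

theorem forestExpr_singleton (t : Tree) : Isotopic (forestExpr [t]) t.expr :=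
  Isotopic.add_nil _

theorem forestExpr_replicate_leaf (n : ℕ) :
    Isotopic (forestExpr (List.replicate n .leaf)) (.triv (List.replicate n ())) := by
  induction n with
  | zero => exact .refl _
  | succ n ih =>
    exact ((Isotopic.refl _).add_congr ih).trans (Isotopic.triv_add _ _)

theorem forestLeaves_replicate_leaf (n : ℕ) : forestLeaves (List.replicate n .leaf) = n := by
  simp [forestLeaves, Tree.leaves]

/-- Grafting a forest onto the leaves of a tree. -/
theorem exists_graft_tree (t : Tree) : ∀ A : List Tree, A.length = t.leaves →
    ∃ u : Tree, Isotopic u.expr (.comp t.expr (forestExpr A)) := by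
  induction t with
  | leaf =>
    intro A hA
    obtain ⟨a, rfl⟩ := List.length_eq_one_iff.1 hA
    exact ⟨a, ((Isotopic.triv_comp' (by simp [forestExpr, top])).trans
      (forestExpr_singleton a)).symm⟩
  | node l r hl hr =>
    intro A hA
    have hA' : A.length = l.leaves + r.leaves := hA
    obtain ⟨B, C, rfl, hB, hC⟩ : ∃ B C, A = B ++ C ∧ B.length = l.leaves ∧
        C.length = r.leaves :=
      ⟨A.take l.leaves, A.drop l.leaves, by simp, by simp; omega, by simp [hA']⟩
    obtain ⟨u, hu⟩ := hl B hB
    obtain ⟨v, hv⟩ := hr C hC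
    refine ⟨.node u v, ?_⟩
    calc Isotopic (Tree.node u v).expr (.comp (.cell [()] [(), ()])
          (.add (.comp l.expr (forestExpr B)) (.comp r.expr (forestExpr C)))) :=
          (Isotopic.refl _).comp_congr (hu.add_congr hv)
      Isotopic _ (.comp (.cell [()] [(), ()]) (.comp (.add l.expr r.expr)
          (.add (forestExpr B) (forestExpr C)))) :=
          (Isotopic.refl _).comp_congr (.interchange _ _ _ _
            (unit_list_ext (by simp [hB])) (unit_list_ext (by simp [hC])))
      Isotopic _ _ := (Isotopic.comp_assoc _ _ _).symm
      Isotopic _ _ := (Isotopic.refl _).comp_congr (forestExpr_append B C).symm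

theorem exists_graft_forest (F : List Tree) : ∀ A : List Tree, A.length = forestLeaves F →
    ∃ F' : List Tree, Isotopic (forestExpr F') (.comp (forestExpr F) (forestExpr A)) := by
  induction F with
  | nil =>
    intro A hA
    obtain rfl := List.length_eq_zero_iff.1 hA
    exact ⟨[], (Isotopic.triv_comp' rfl).symm⟩
  | cons t F ih =>
    intro A hA
    rw [forestLeaves_cons] at hA
    obtain ⟨B, C, rfl, hB, hC⟩ : ∃ B C, A = B ++ C ∧ B.length = t.leaves ∧
        C.length = forestLeaves F :=
      ⟨A.take t.leaves, A.drop t.leaves, by simp, by simp; omega, by simp; omega⟩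
    obtain ⟨u, hu⟩ := exists_graft_tree t B hB
    obtain ⟨F', hF'⟩ := ih C hC
    refine ⟨u :: F', ?_⟩
    calc Isotopic _ _ := hu.add_congr hF'
      Isotopic _ (.comp (.add t.expr (forestExpr F)) (.add (forestExpr B) (forestExpr C))) :=
          .interchange _ _ _ _ (unit_list_ext (by simp [hB])) (unit_list_ext (by simp [hC]))
      Isotopic _ _ := (Isotopic.refl _).comp_congr (forestExpr_append B C).symm

/-- The expression is isotopic to a forest of splitting cells on top of an inverted forest. -/
def IsNormal (d : Expr Unit) : Prop :=
  ∃ A B : List Tree, forestLeaves A = forestLeaves B ∧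
    Isotopic d (.comp (forestExpr A) (forestExpr B).inv)

theorem IsNormal.isotopic {d e : Expr Unit} (h : IsNormal e) (hde : Isotopic d e) :
    IsNormal d := by
  obtain ⟨A, B, hAB, h⟩ := h
  exact ⟨A, B, hAB, hde.trans h⟩

theorem isNormal_forestExpr (F : List Tree) : IsNormal (forestExpr F) := by
  refine ⟨F, List.replicate (forestLeaves F) .leaf, (forestLeaves_replicate_leaf _).symm, ?_⟩
  exact ((Isotopic.refl _).comp_congr (forestExpr_replicate_leaf _).inv).trans
    (Isotopic.comp_triv' (unit_list_ext (by simp))) |>.symm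

theorem IsNormal.inv {d : Expr Unit} (h : IsNormal d) : IsNormal d.inv := by
  obtain ⟨A, B, hAB, h⟩ := h
  exact ⟨B, A, hAB.symm, by simpa [Expr.inv] using h.inv⟩

theorem isNormal_tree (t : Tree) : IsNormal t.expr :=
  (isNormal_forestExpr [t]).isotopic (forestExpr_singleton t).symm

theorem IsNormal.add {d e : Expr Unit} (hd : IsNormal d) (he : IsNormal e) :
    IsNormal (.add d e) := by
  obtain ⟨A, B, hAB, hd⟩ := hd
  obtain ⟨C, D, hCD, he⟩ := he
  refine ⟨A ++ C, B ++ D, by simp [*], (hd.add_congr he).trans ?_⟩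
  refine (Isotopic.interchange _ _ _ _ (unit_list_ext (by simp [hAB]))
    (unit_list_ext (by simp [hCD]))).trans ?_
  exact (forestExpr_append A C).symm.comp_congr (forestExpr_append B D).inv.symm

/-- If both trees have a root cell, the merging root of the inverted `s` faces the splitting root of
`t`, which is a dipole. Otherwise one factor is trivial and the product is a single tree or inverted
tree. -/
theorem hasDipole_or_isNormal_tree (s t : Tree) :
    HasDipole (.comp s.expr.inv t.expr) ∨ IsNormal (.comp s.expr.inv t.expr) := by
  cases s with
  | leaf => exact .inr ((isNormal_tree t).isotopic (Isotopic.triv_comp' (by simp)))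
  | node s s' =>
    cases t with
    | leaf => exact .inr ((isNormal_tree _).inv.isotopic (Isotopic.comp_triv' (by simp)))
    | node t t' =>
      exact .inl (.isotopic (Isotopic.comp4 _ _ _ _).symm
        (.comp_right (.comp_left (.cell _ _))))

theorem hasDipole_or_isNormal_forest : ∀ F G : List Tree, F.length = G.length →
    HasDipole (.comp (forestExpr F).inv (forestExpr G)) ∨
      IsNormal (.comp (forestExpr F).inv (forestExpr G))
  | [], [], _ => .inr ((isNormal_forestExpr []).isotopic (Isotopic.triv_comp' rfl))
  | s :: F, t :: G, h => by
    have h' : F.length = G.length := by simpa using h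
    have hi : Isotopic (.comp (forestExpr (s :: F)).inv (forestExpr (t :: G)))
        (.add (.comp s.expr.inv t.expr) (.comp (forestExpr F).inv (forestExpr G))) :=
      (Isotopic.interchange _ _ _ _ (by simp) (unit_list_ext (by simp [h']))).symm
    rcases hasDipole_or_isNormal_tree s t with hs | hs
    · exact .inl (.isotopic hi.symm (.add_left hs))
    rcases hasDipole_or_isNormal_forest F G h' with hF | hF
    · exact .inl (.isotopic hi.symm (.add_right hF))
    · exact .inr ((hs.add hF).isotopic hi)

/-- A diagram over `{x² → x}` without dipoles splits all edges before it merges any. -/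
theorem hasDipole_or_isNormal (d : Expr Unit) (hd : d.IsDiagram thompsonCells) :
    HasDipole d ∨ IsNormal d := by
  induction d with
  | triv w =>
    right
    refine (isNormal_forestExpr (List.replicate w.length .leaf)).isotopic ?_
    have : w = List.replicate w.length () := unit_list_ext (by simp)
    rw [List.length_replicate.symm.trans (congrArg List.length this.symm)]
    conv_lhs => rw [this]
    exact (forestExpr_replicate_leaf _).symm
  | cell u v =>
    right
    have key : Isotopic (Tree.node .leaf .leaf).expr (.cell [()] [(), ()]) :=
      ((Isotopic.refl _).comp_congr (Isotopic.triv_add _ _)).trans (Isotopic.comp_triv' rfl)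
    have hn := (isNormal_tree (.node .leaf .leaf)).isotopic key.symm
    rcases hd with h | h
    · obtain ⟨rfl, rfl⟩ := Prod.mk.inj h
      exact hn.inv
    · obtain ⟨rfl, rfl⟩ := Prod.mk.inj h
      exact hn
  | add d e ihd ihe =>
    rcases ihd hd.1 with h | h
    · exact .inl (.add_left h)
    rcases ihe hd.2 with h' | h'
    · exact .inl (.add_right h')
    · exact .inr (h.add h')
  | comp d e ihd ihe =>
    rcases ihd hd.1 with h | ⟨A, B, hAB, h⟩
    · exact .inl (.comp_left h)
    rcases ihe hd.2.1 with h' | ⟨C, D, hCD, h'⟩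
    · exact .inl (.comp_right h')
    -- The product is A ∘ (B⁻¹ ∘ C) ∘ D⁻¹. Once the middle is rewritten as A' ∘ B'⁻¹, the forest A'
    -- is grafted onto A and B' onto D.
    have hi := (h.comp_congr h').trans (Isotopic.comp4 _ _ _ _)
    have hBC : B.length = C.length := by
      have h1 := h.bot_eq
      have h2 := h'.top_eq
      have h3 := hd.2.2
      simp only [bot, top, bot_inv] at h1 h2
      simpa using congrArg List.length (h1.symm.trans (h3.trans h2))
    rcases hasDipole_or_isNormal_forest B C hBC with hd | ⟨A', B', hAB', hn⟩
    · exact .inl (.isotopic hi.symm (.comp_right (.comp_left hd)))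
    right
    have ht := congrArg List.length hn.top_eq
    have hb := congrArg List.length hn.bot_eq
    simp only [top, bot, top_inv, bot_inv, length_bot_forestExpr, length_top_forestExpr] at ht hb
    obtain ⟨F, hF⟩ := exists_graft_forest A A' (by omega)
    obtain ⟨G, hG⟩ := exists_graft_forest D B' (by omega)
    have hFb := congrArg List.length hF.bot_eq
    have hGb := congrArg List.length hG.bot_eq
    simp only [bot, length_bot_forestExpr] at hFb hGb
    refine ⟨F, G, by omega, hi.trans ?_⟩
    calc Isotopic _ (.comp (forestExpr A) (.comp (.comp (forestExpr A') (forestExpr B').inv)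
          (forestExpr D).inv)) := (Isotopic.refl _).comp_congr (hn.comp_congr (.refl _))
      Isotopic _ _ := (Isotopic.comp4 _ _ _ _).symm
      Isotopic _ _ := hF.symm.comp_congr hG.inv.symm

/-! ### The action of diagrams on edges and points of the Cantor set -/

namespace Expr

/-- The action of a diagram over `{x² → x}` on pairs consisting of the index of an edge and a
point of the Cantor set: the cell `(x → x²)` reads off one letter, and its inverse adds one. -/
def act {X : Type*} : Expr X → ℕ × Stream' Bool → ℕ × Stream' Bool
  | triv _, p => p
  | cell u v, p =>
    if u.length < v.length then (if p.2.head then 1 else 0, p.2.tail)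
    else (0, Stream'.cons (decide (p.1 = 1)) p.2)
  | add d e, p =>
    if p.1 < d.top.length then d.act p
    else ((e.act (p.1 - d.top.length, p.2)).1 + d.bot.length,
      (e.act (p.1 - d.top.length, p.2)).2)
  | comp d e, p => e.act (d.act p)

theorem act_add_of_lt {X : Type*} {d e : Expr X} {p : ℕ × Stream' Bool}
    (h : p.1 < d.top.length) : (add d e).act p = d.act p := if_pos h

theorem act_add_of_le {X : Type*} {d e : Expr X} {p : ℕ × Stream' Bool}
    (h : d.top.length ≤ p.1) : (add d e).act p =
      ((e.act (p.1 - d.top.length, p.2)).1 + d.bot.length,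
        (e.act (p.1 - d.top.length, p.2)).2) := if_neg (not_lt.2 h)

/-- `act` has arbitrary values at indices beyond the top path; this keeps every intermediate index
in range. -/
theorem act_lt {d : Expr Unit} (hd : d.IsDiagram thompsonCells) : ∀ {p : ℕ × Stream' Bool},
    p.1 < d.top.length → (d.act p).1 < d.bot.length := by
  induction d with
  | triv w => exact id
  | cell u v =>
    intro p hp
    rcases hd with h | h <;> obtain ⟨rfl, rfl⟩ := Prod.mk.inj h
    · simp [act, bot]
    · simp only [act, bot, List.length_cons, List.length_nil]
      norm_num
      split_ifs <;> norm_num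
  | add d e ihd ihe =>
    intro p hp
    simp only [top, List.length_append] at hp
    simp only [act, bot, List.length_append]
    split_ifs with h
    · exact (ihd hd.1 h).trans_le (Nat.le_add_right _ _)
    · have := ihe hd.2 (p := (p.1 - d.top.length, p.2)) (by simp only; omega)
      omega
  | comp d e ihd ihe =>
    intro p hp
    exact ihe hd.2.1 (hd.2.2 ▸ ihd hd.1 hp)

theorem act_inv_act {d : Expr Unit} (hd : d.IsDiagram thompsonCells) :
    ∀ {p : ℕ × Stream' Bool}, p.1 < d.top.length → d.inv.act (d.act p) = p := by
  induction d with
  | triv w => exact fun _ => rfl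
  | cell u v =>
    rintro ⟨i, s⟩ hp
    rcases hd with h | h <;> obtain ⟨rfl, rfl⟩ := Prod.mk.inj h
    · simp only [top, List.length_cons, List.length_nil] at hp
      interval_cases i <;> simp [act, Expr.inv, Stream'.tail_cons]
    · simp only [top, List.length_cons, List.length_nil] at hp
      interval_cases i
      obtain ⟨b, s, rfl⟩ : ∃ b t, s = Stream'.cons b t := ⟨_, _, (Stream'.eta s).symm⟩
      cases b <;> simp [act, Expr.inv, Stream'.tail_cons]
  | add d e ihd ihe =>
    intro p hp
    simp only [top, List.length_append] at hp
    simp only [act, Expr.inv, top_inv, bot_inv]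
    split_ifs with h h1 h2
    · exact ihd hd.1 h
    · exact absurd (act_lt hd.1 h) h1
    · simp at h2
    · have := ihe hd.2 (p := (p.1 - d.top.length, p.2)) (by simp only; omega)
      simp only [Nat.add_sub_cancel, this]
      exact Prod.ext (Nat.sub_add_cancel (not_lt.1 h)) rfl
  | comp d e ihd ihe =>
    intro p hp
    simp only [act, Expr.inv]
    rw [ihe hd.2.1 (hd.2.2 ▸ act_lt hd.1 hp), ihd hd.1 hp]

/-- The bound on the index is essential: already for `add_nil`, an index beyond the top path is sent
to the empty summand on one side and to `d` on the other. -/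
theorem Isotopic.act_eq {d e : Expr Unit} (h : Isotopic d e) :
    ∀ (_ : d.IsDiagram thompsonCells) {p : ℕ × Stream' Bool}, p.1 < d.top.length →
      d.act p = e.act p := by
  induction h with
  | refl d => exact fun _ _ _ => rfl
  | symm h ih =>
    intro hd p hp
    exact (ih (h.isDiagram_iff.2 hd) (h.top_eq ▸ hp)).symm
  | trans h _ ih ih' =>
    intro hd p hp
    exact (ih hd hp).trans (ih' (h.isDiagram_iff.1 hd) (h.top_eq ▸ hp))
  | add_congr h h' ih ih' =>
    intro hd p hp
    simp only [top, List.length_append] at hp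
    simp only [act, ← h.top_eq, ← h.bot_eq]
    split_ifs with hl
    · exact ih hd.1 hl
    · rw [ih' hd.2 (p := (_, p.2)) (by simp only; omega)]
  | comp_congr h h' ih ih' =>
    intro hd p hp
    simp only [act]
    rw [← ih hd.1 hp, ih' hd.2.1 (hd.2.2 ▸ act_lt hd.1 hp)]
  | add_assoc d e f =>
    intro hd p hp
    simp only [act, top, bot, List.length_append]
    by_cases h1 : p.1 < d.top.length
    · simp [h1, Nat.lt_add_right]
    · by_cases h2 : p.1 < d.top.length + e.top.length
      · have h3 : p.1 - d.top.length < e.top.length := by omega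
        simp [h1, h2, h3]
      · have h3 : ¬ p.1 - d.top.length < e.top.length := by omega
        simp only [h1, h2, h3, if_false, Nat.sub_sub, Prod.mk.injEq, and_true]
        omega
  | nil_add d => intro hd p hp; simp [act, top, bot]
  | add_nil d =>
    intro hd p hp
    have hp' : p.1 < d.top.length := by simpa [top] using hp
    simp [act, hp']
  | triv_add u v =>
    intro hd p hp
    rcases lt_or_ge p.1 u.length with h | h
    · exact act_add_of_lt h
    · exact (act_add_of_le (d := triv u) h).trans (Prod.ext (Nat.sub_add_cancel h) rfl)
  | comp_assoc d e f => exact fun _ _ _ => rfl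
  | triv_comp d => exact fun _ _ _ => rfl
  | comp_triv d => exact fun _ _ _ => rfl
  | interchange d d' e e' h h' =>
    intro hd p hp
    -- After the upper row the point is still in the same column, because `d` maps its top path into
    -- its bottom path.
    change _ = (add d' e').act ((add d e).act p)
    rcases lt_or_ge p.1 d.top.length with h1 | h1
    · rw [act_add_of_lt (d := comp d d') h1, act_add_of_lt h1,
        act_add_of_lt (h ▸ act_lt hd.1.1 h1)]
      rfl
    · rw [act_add_of_le (d := comp d d') h1, act_add_of_le h1, act_add_of_le (by simp [h])]
      simp [act, h, top, bot]

theorem act_dipole (p q a b : List Unit) (h : (a, b) ∈ thompsonCells ∨ (b, a) ∈ thompsonCells)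
    (x : ℕ × Stream' Bool) :
    (add (add (triv p) (comp (cell a b) (cell b a))) (triv q)).act x = x := by
  have key : ∀ y : ℕ × Stream' Bool, y.1 < a.length →
      (comp (cell a b) (cell b a)).act y = y := fun y hy =>
    act_inv_act (d := cell a b) h hy
  rcases lt_or_ge x.1 (p ++ a).length with h1 | h1
  · rw [act_add_of_lt h1]
    rcases lt_or_ge x.1 p.length with h2 | h2
    · rw [act_add_of_lt h2, act]
    · rw [List.length_append] at h1
      rw [act_add_of_le (d := triv p) h2, key _ (by simp only [top]; omega)]
      exact Prod.ext (Nat.sub_add_cancel h2) rfl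
  · rw [act_add_of_le (d := add (triv p) (comp (cell a b) (cell b a))) h1]
    exact Prod.ext (Nat.sub_add_cancel h1) rfl

end Expr

/-! ### Trees as prefix codes, their internal nodes, and dipoles from common subtrees -/

namespace Tree

/-- The leaf reached by following a point of the Cantor set, with the remaining letters. -/
def descend : Tree → Stream' Bool → ℕ × Stream' Bool
  | leaf, s => (0, s)
  | node l r, s =>
    if s.head then (l.leaves + (r.descend s.tail).1, (r.descend s.tail).2) else l.descend s.tail

@[simp] theorem descend_leaf (s : Stream' Bool) : leaf.descend s = (0, s) := rfl

@[simp] theorem descend_node_false (l r : Tree) (s : Stream' Bool) :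
    (node l r).descend (Stream'.cons false s) = l.descend s := rfl

@[simp] theorem descend_node_true (l r : Tree) (s : Stream' Bool) :
    (node l r).descend (Stream'.cons true s) = (l.leaves + (r.descend s).1, (r.descend s).2) := rfl

theorem act_expr (t : Tree) (s : Stream' Bool) : t.expr.act (0, s) = t.descend s := by
  induction t generalizing s with
  | leaf => rfl
  | node l r hl hr =>
    obtain ⟨b, s, rfl⟩ : ∃ b t, s = Stream'.cons b t := ⟨_, _, (Stream'.eta s).symm⟩
    cases b <;>
      simp [expr, act, Stream'.tail_cons, hl, hr, Nat.add_comm]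

theorem leaves_pos (t : Tree) : 0 < t.leaves := by
  rw [leaves_eq_cells_add_one]; omega

theorem descend_lt (t : Tree) (s : Stream' Bool) : (t.descend s).1 < t.leaves := by
  simpa [act_expr] using act_lt t.isDiagram_expr (p := (0, s)) (by simp)

theorem descend_injective (t : Tree) : Function.Injective t.descend := by
  intro s s' h
  rw [← act_expr, ← act_expr] at h
  have h1 := congrArg t.expr.inv.act h
  rw [act_inv_act t.isDiagram_expr (by simp), act_inv_act t.isDiagram_expr (by simp)] at h1
  exact (Prod.mk.inj h1).2

/-- The point 000… finds the leftmost leaf of a subtree, hence the number of leaves to the left of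
that subtree. -/
theorem descend_const_false (t : Tree) : (t.descend (Stream'.const false)).1 = 0 := by
  induction t with
  | leaf => rfl
  | node l r hl _ =>
    rw [Stream'.const_eq]
    simpa using hl

/-- The point 1000… ends in the leftmost leaf of the right subtree, whose index is the number of
leaves on the left. This separates a leaf from a node and lets the comparison split into the two
halves. -/
theorem eq_of_descend_eq : ∀ {t u : Tree}, t.descend = u.descend → t = u
  | leaf, leaf, _ => rfl
  | leaf, node l r, h => by
    have := congrArg Prod.fst (congrFun h (Stream'.cons true (Stream'.const false)))
    have := l.leaves_pos
    simp at *
    omega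
  | node l r, leaf, h => by
    have := congrArg Prod.fst (congrFun h (Stream'.cons true (Stream'.const false)))
    have := l.leaves_pos
    simp at *
    omega
  | node l r, node l' r', h => by
    have h0 : l.leaves = l'.leaves := by
      simpa [descend_const_false] using
        congrArg Prod.fst (congrFun h (Stream'.cons true (Stream'.const false)))
    rw [eq_of_descend_eq (t := l) (u := l') (funext fun s => congrFun h (Stream'.cons false s)),
      eq_of_descend_eq (t := r) (u := r') (funext fun s => ?_)]
    have := congrFun h (Stream'.cons true s)
    simp only [descend_node_true, h0, Prod.mk.injEq, Nat.add_left_cancel_iff] at this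
    exact Prod.ext this.1 this.2

theorem exists_address (t : Tree) : ∀ {i : ℕ}, i < t.leaves →
    ∃ v : List Bool, ∀ s, t.descend (v ++ₛ s) = (i, s) := by
  induction t with
  | leaf =>
    intro i hi
    obtain rfl : i = 0 := Nat.lt_one_iff.1 hi
    exact ⟨[], fun s => rfl⟩
  | node l r hl hr =>
    intro i hi
    by_cases h : i < l.leaves
    · obtain ⟨v, hv⟩ := hl h
      exact ⟨false :: v, fun s => hv s⟩
    · have hi' : i < l.leaves + r.leaves := hi
      obtain ⟨v, hv⟩ := hr (i := i - l.leaves) (by omega)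
      refine ⟨true :: v, fun s => ?_⟩
      rw [Stream'.cons_append_stream, descend_node_true, hv]
      exact Prod.ext (Nat.add_sub_cancel' (not_lt.1 h)) rfl

/-- The addresses of the internal nodes. -/
def nodes : Tree → Finset (List Bool)
  | leaf => ∅
  | node l r => insert [] (l.nodes.map ⟨_, List.cons_injective (a := false)⟩ ∪
      r.nodes.map ⟨_, List.cons_injective (a := true)⟩)

@[simp] theorem notMem_nodes_leaf (v : List Bool) : v ∉ leaf.nodes := by simp [nodes]

@[simp] theorem nil_mem_nodes (l r : Tree) : [] ∈ (node l r).nodes := by simp [nodes]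

@[simp] theorem false_cons_mem_nodes (l r : Tree) (v : List Bool) :
    false :: v ∈ (node l r).nodes ↔ v ∈ l.nodes := by simp [nodes]

@[simp] theorem true_cons_mem_nodes (l r : Tree) (v : List Bool) :
    true :: v ∈ (node l r).nodes ↔ v ∈ r.nodes := by simp [nodes]

theorem card_nodes (t : Tree) : t.nodes.card = t.expr.cells := by
  induction t with
  | leaf => rfl
  | node l r hl hr =>
    rw [nodes, Finset.card_insert_of_notMem (by simp), Finset.card_union_of_disjoint ?_]
    · simp [expr, cells, hl, hr]; omega
    · simp [Finset.disjoint_left]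

theorem eq_of_nodes_eq : ∀ {t u : Tree}, t.nodes = u.nodes → t = u
  | leaf, leaf, _ => rfl
  | leaf, node l r, h => absurd (h ▸ nil_mem_nodes l r) (notMem_nodes_leaf _)
  | node l r, leaf, h => absurd (h ▸ nil_mem_nodes l r) (notMem_nodes_leaf _)
  | node l r, node l' r', h => by
    rw [eq_of_nodes_eq (t := l) (u := l') (Finset.ext fun v => ?_),
      eq_of_nodes_eq (t := r) (u := r') (Finset.ext fun v => ?_)]
    · rw [← true_cons_mem_nodes l r, h, true_cons_mem_nodes]
    · rw [← false_cons_mem_nodes l r, h, false_cons_mem_nodes]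

/-- `u` is the subtree of `t` at the address `v`, and `i` leaves of `t` lie to its left. -/
inductive At : Tree → List Bool → ℕ → Tree → Prop
  | root (t) : At t [] 0 t
  | left {l r v i u} : At l v i u → At (node l r) (false :: v) i u
  | right {l r v i u} : At r v i u → At (node l r) (true :: v) (l.leaves + i) u

theorem At.descend {t u : Tree} {v : List Bool} {i : ℕ} (h : At t v i u) (s : Stream' Bool) :
    t.descend (v ++ₛ s) = (i + (u.descend s).1, (u.descend s).2) := by
  induction h with
  | root t => simp
  | left _ ih => simpa [Stream'.cons_append_stream] using ih
  | right _ ih => simp [Stream'.cons_append_stream, ih, Nat.add_assoc]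

theorem exists_at_of_mem_nodes {t : Tree} : ∀ {v : List Bool}, v ∈ t.nodes →
    ∃ i l r, At t v i (node l r) := by
  induction t with
  | leaf => simp
  | node l r hl hr =>
    rintro (_ | ⟨_ | _, v⟩) h
    · exact ⟨0, l, r, .root _⟩
    · obtain ⟨i, l', r', h'⟩ := hl ((false_cons_mem_nodes l r v).1 h)
      exact ⟨i, l', r', h'.left⟩
    · obtain ⟨i, l', r', h'⟩ := hr ((true_cons_mem_nodes l r v).1 h)
      exact ⟨_, l', r', h'.right⟩

/-- An address that is not an internal node runs into a leaf; `c` is the part of it left over below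
that leaf. -/
theorem exists_descend_of_notMem_nodes {t : Tree} : ∀ {v : List Bool}, v ∉ t.nodes →
    ∃ i c, i < t.leaves ∧ ∀ s, t.descend (v ++ₛ s) = (i, c ++ₛ s) := by
  induction t with
  | leaf => exact fun {v} _ => ⟨0, v, Nat.one_pos, fun s => rfl⟩
  | node l r hl hr =>
    rintro (_ | ⟨_ | _, v⟩) h
    · simp at h
    · obtain ⟨i, c, hi, h'⟩ := hl (mt (false_cons_mem_nodes l r v).2 h)
      exact ⟨i, c, Nat.lt_add_right _ hi, h'⟩
    · obtain ⟨i, c, hi, h'⟩ := hr (mt (true_cons_mem_nodes l r v).2 h)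
      refine ⟨l.leaves + i, c, Nat.add_lt_add_left hi _, fun s => ?_⟩
      simp [Stream'.cons_append_stream, h']

/-- A subtree can be drawn below the rest of the tree. -/
theorem At.exists_isotopic {t u : Tree} {v : List Bool} {i : ℕ} (h : At t v i u) :
    ∃ (c : Expr Unit) (j : ℕ), c.bot.length = i + 1 + j ∧
      Isotopic t.expr (.comp c (.add (.add (.triv (List.replicate i ())) u.expr)
        (.triv (List.replicate j ())))) := by
  induction h with
  | root t =>
    refine ⟨.triv [()], 0, rfl, ?_⟩
    exact (((Isotopic.triv_comp' (by simp [top])).trans (Isotopic.add_nil _)).trans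
      (Isotopic.nil_add _)).symm
  | @left l r v i u _ ih =>
    obtain ⟨c, j, hc, hi⟩ := ih
    refine ⟨.comp (.cell [()] [(), ()]) (.add c r.expr), j + r.leaves, ?_, ?_⟩
    · simp [bot, hc]; omega
    refine Isotopic.trans ?_ (Isotopic.comp_assoc _ _ _).symm
    refine (Isotopic.refl _).comp_congr ?_
    refine (hi.add_congr (Isotopic.comp_triv' (w := List.replicate r.leaves ())
      (unit_list_ext (by simp))).symm).trans ?_
    refine (Isotopic.interchange _ _ _ _ (unit_list_ext (by simp [top, hc]; omega))
      (unit_list_ext (by simp [top]))).trans ((Isotopic.refl _).comp_congr ?_)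
    refine (Isotopic.add_assoc _ _ _).trans ((Isotopic.refl _).add_congr ?_)
    rw [List.replicate_add]
    exact .triv_add _ _
  | @right l r v i u _ ih =>
    obtain ⟨c, j, hc, hi⟩ := ih
    refine ⟨.comp (.cell [()] [(), ()]) (.add l.expr c), j, ?_, ?_⟩
    · simp [bot, hc]; omega
    refine Isotopic.trans ?_ (Isotopic.comp_assoc _ _ _).symm
    refine (Isotopic.refl _).comp_congr ?_
    refine ((Isotopic.comp_triv' (w := List.replicate l.leaves ())
      (unit_list_ext (by simp))).symm.add_congr hi).trans ?_
    refine (Isotopic.interchange _ _ _ _ (unit_list_ext (by simp [top]))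
      (unit_list_ext (by simp [top, hc]; omega))).trans ((Isotopic.refl _).comp_congr ?_)
    refine (Isotopic.add_assoc _ _ _).symm.trans (Isotopic.add_congr ?_ (.refl _))
    refine (Isotopic.add_assoc _ _ _).symm.trans (Isotopic.add_congr ?_ (.refl _))
    rw [List.replicate_add]
    exact .triv_add _ _

/-- By recursion, either some subtree already meets its inverse in a dipole, or both subtrees are
trivial and the two root cells become adjacent. -/
theorem isotopic_triv_or_hasDipole (t : Tree) :
    Isotopic (.comp t.expr t.expr.inv) (.triv [()]) ∨ HasDipole (.comp t.expr t.expr.inv) := by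
  cases t with
  | leaf => exact .inl (.triv_comp (.triv [()]))
  | node l r =>
    right
    refine .isotopic (Isotopic.comp4 _ _ _ _).symm ?_
    have hi : Isotopic (.comp (.add l.expr r.expr) (.add l.expr.inv r.expr.inv))
        (.add (.comp l.expr l.expr.inv) (.comp r.expr r.expr.inv)) :=
      (Isotopic.interchange _ _ _ _ (by simp) (by simp)).symm
    rcases l.isotopic_triv_or_hasDipole with hl | hl
    · rcases r.isotopic_triv_or_hasDipole with hr | hr
      · have h2 := (hi.trans (hl.add_congr hr)).trans (.triv_add _ _)
        exact .isotopic ((Isotopic.refl _).comp_congr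
          ((h2.comp_congr (.refl _)).trans (Isotopic.triv_comp' rfl))).symm (.cell _ _)
      · exact .comp_right (.comp_left (.isotopic hi.symm (.add_right hr)))
    · exact .comp_right (.comp_left (.isotopic hi.symm (.add_left hl)))

/-- Both copies of the subtree can be drawn next to the gluing path. Equal offsets on the left, and
equal leaf counts overall, place them exactly opposite each other. -/
theorem hasDipole_of_at {t t' l r : Tree} {v v' : List Bool} {i : ℕ}
    (hl : t.leaves = t'.leaves) (h : At t v i (node l r)) (h' : At t' v' i (node l r)) :
    HasDipole (.comp t.expr t'.expr.inv) := by
  obtain ⟨c, j, hc, hi⟩ := h.exists_isotopic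
  obtain ⟨c', j', hc', hi'⟩ := h'.exists_isotopic
  obtain rfl : j = j' := by
    have h1 := congrArg List.length hi.bot_eq
    have h2 := congrArg List.length hi'.bot_eq
    simp only [length_bot_expr, bot, List.length_append, List.length_replicate] at h1 h2
    omega
  refine .isotopic ((hi.comp_congr hi'.inv).trans (Isotopic.comp4 _ _ _ _)).symm
    (.comp_right (.comp_left ?_))
  refine .isotopic (Isotopic.interchange _ _ _ _ (by simp [bot]) rfl) (.add_left ?_)
  refine .isotopic (Isotopic.interchange _ _ _ _ rfl (by simp)) (.add_right ?_)
  -- The product cannot be trivial, since it has cells and isotopy preserves their number.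
  refine ((node l r).isotopic_triv_or_hasDipole).resolve_left fun h => ?_
  simpa [expr, cells] using h.cells_eq

end Tree

/-! ### The faithful action of F, uniqueness of reduced diagrams, and the length formula -/

/-- The action of an `(x, x)`-diagram on the Cantor set. -/
def ThompsonDiagram.act : ThompsonDiagram → Stream' Bool → Stream' Bool :=
  Quotient.lift (fun d s => (d.1.act (0, s)).2) fun d _ h => funext fun s =>
    congrArg Prod.snd (h.act_eq d.2.1 (p := (0, s)) (by rw [d.2.2.1]; exact Nat.one_pos))

theorem ThompsonDiagram.act_dipoleStep {D D' : ThompsonDiagram} (h : Diagram.DipoleStep D D') :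
    ThompsonDiagram.act D = ThompsonDiagram.act D' := by
  obtain ⟨w, p, a, b, q, h, hw, A, B, rfl, rfl⟩ := h
  induction A using Quotient.inductionOn with
  | h A => induction B using Quotient.inductionOn with
    | h B =>
      funext s
      exact congrArg (fun p => (B.1.act p).2) (act_dipole p q a b h _)

/-- The action of Thompson's group on the Cantor set. -/
def ThompsonF.act : ThompsonF → Stream' Bool → Stream' Bool :=
  Quot.lift ThompsonDiagram.act fun _ _ h => ThompsonDiagram.act_dipoleStep h

theorem ThompsonF.act_one (s : Stream' Bool) : ThompsonF.act 1 s = s := rfl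

/-- A right action: the upper diagram acts first. Dropping the edge index is harmless, as the path
between the factors has only edge 0. -/
theorem ThompsonF.act_mul (g h : ThompsonF) (s : Stream' Bool) :
    ThompsonF.act (g * h) s = ThompsonF.act h (ThompsonF.act g s) := by
  induction g using Quot.ind with
  | mk D => induction h using Quot.ind with
    | mk E => induction D using Quotient.inductionOn with
      | h d => induction E using Quotient.inductionOn with
        | h e =>
          have hd := act_lt d.2.1 (p := (0, s)) (by rw [d.2.2.1]; exact Nat.one_pos)
          rw [d.2.2.2] at hd
          have : d.1.act (0, s) = (0, (d.1.act (0, s)).2) :=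
            Prod.ext (Nat.lt_one_iff.1 hd) rfl
          exact congrArg (fun p => (e.1.act p).2) this

theorem ThompsonF.act_inv_act (g : ThompsonF) (s : Stream' Bool) :
    ThompsonF.act g⁻¹ (ThompsonF.act g s) = s := by
  rw [← ThompsonF.act_mul, mul_inv_cancel, ThompsonF.act_one]

theorem ThompsonF.act_act_inv (g : ThompsonF) (s : Stream' Bool) :
    ThompsonF.act g (ThompsonF.act g⁻¹ s) = s := by
  rw [← ThompsonF.act_mul, inv_mul_cancel, ThompsonF.act_one]

/-- `f` replaces the prefix `v` by another prefix. -/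
def Good (f : Stream' Bool → Stream' Bool) (v : List Bool) : Prop :=
  ∃ w : List Bool, ∀ s, f (v ++ₛ s) = w ++ₛ s

/-- The diagram given by a pair of trees with the same number of leaves. -/
def treePair (t u : Tree) (h : t.leaves = u.leaves) : ThompsonDiagram :=
  (Expr.comp t.expr u.expr.inv).toDiagram
    ⟨t.isDiagram_expr, isDiagram_inv u.isDiagram_expr, unit_list_ext (by simp [h])⟩
    t.top_expr (u.expr.bot_inv.trans u.top_expr)

/-- Characterises the map of a tree pair, since `u.descend` is injective: a leaf address of `t`
becomes the corresponding leaf address of `u`. -/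
theorem descend_act_treePair {t u : Tree} (h : t.leaves = u.leaves) (s : Stream' Bool) :
    u.descend ((treePair t u h).act s) = t.descend s := by
  change u.descend (u.expr.inv.act (t.expr.act (0, s))).2 = _
  rw [t.act_expr]
  obtain ⟨v, hv⟩ := u.exists_address (h ▸ t.descend_lt s)
  have h1 : t.descend s = u.expr.act (0, v ++ₛ (t.descend s).2) := by
    rw [u.act_expr, hv]
  rw [h1, Expr.act_inv_act u.isDiagram_expr (by simp), ← u.act_expr]

theorem cells_treePair {t u : Tree} (h : t.leaves = u.leaves) :
    (treePair t u h).cells = 2 * t.nodes.card := by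
  have h1 : (treePair t u h).cells = t.expr.cells + u.expr.inv.cells := rfl
  rw [h1, cells_inv, t.card_nodes]
  have := t.leaves_eq_cells_add_one
  have := u.leaves_eq_cells_add_one
  omega

theorem exists_eq_treePair {D : ThompsonDiagram} (hD : D.Reduced) :
    ∃ t u h, D = treePair t u h := by
  induction D using Quotient.inductionOn with
  | h d =>
    obtain ⟨d, hd, hu, hv⟩ := d
    rcases hasDipole_or_isNormal d hd with h | ⟨A, B, hAB, hi⟩
    · obtain ⟨D', h'⟩ := h.exists_dipoleStep hd hu hv
      exact absurd h' (hD D')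
    have hA := congrArg List.length (hi.top_eq.symm.trans hu)
    have hB := congrArg List.length (hi.bot_eq.symm.trans hv)
    simp only [top, bot, length_top_forestExpr, bot_inv] at hA hB
    obtain ⟨t, rfl⟩ := List.length_eq_one_iff.1 hA
    obtain ⟨u, rfl⟩ := List.length_eq_one_iff.1 hB
    refine ⟨t, u, by simpa using hAB, ?_⟩
    exact Isotopic.toDiagram_eq (hd := hd) (hu := hu) (hv := hv) (hi.trans ((forestExpr_singleton t).comp_congr
      (forestExpr_singleton u).inv))

/-- Below a leaf of `t` the map exchanges prefixes. Conversely, if it replaced an internal node `v`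
of `t` by `w`, then `u` would have at `w` the subtree that `t` has at `v`, above the same leaves,
contradicting reducedness. -/
theorem mem_nodes_iff {t u : Tree} {h : t.leaves = u.leaves} (hr : (treePair t u h).Reduced)
    (v : List Bool) : v ∈ t.nodes ↔ ¬ Good (treePair t u h).act v := by
  have hd : ¬ HasDipole (.comp t.expr u.expr.inv) := fun hd => by
    obtain ⟨D', h'⟩ := hd.exists_dipoleStep (P := thompsonCells)
      ⟨t.isDiagram_expr, isDiagram_inv u.isDiagram_expr, unit_list_ext (by simp [h])⟩
      t.top_expr (u.expr.bot_inv.trans u.top_expr)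
    exact hr D' h'
  have hf := descend_act_treePair h
  constructor
  · rintro hv ⟨w, hw⟩
    obtain ⟨i, l, r, hi⟩ := Tree.exists_at_of_mem_nodes hv
    have key : ∀ s, u.descend (w ++ₛ s) =
        (i + ((Tree.node l r).descend s).1, ((Tree.node l r).descend s).2) := fun s => by
      rw [← hw, hf, hi.descend]
    by_cases hwu : w ∈ u.nodes
    · obtain ⟨j, l', r', hj⟩ := Tree.exists_at_of_mem_nodes hwu
      have hij : i = j := by
        have h1 := key (Stream'.const false)
        rw [hj.descend] at h1
        simpa [Tree.descend_const_false] using (congrArg Prod.fst h1).symm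
      subst hij
      have hlr : Tree.node l r = Tree.node l' r' := by
        refine Tree.eq_of_descend_eq (funext fun s => ?_)
        have h1 := key s
        rw [hj.descend] at h1
        obtain ⟨h1, h2⟩ := Prod.mk.inj h1
        exact Prod.ext (Nat.add_left_cancel h1).symm h2.symm
      exact hd (Tree.hasDipole_of_at h hi (hlr ▸ hj))
    · obtain ⟨j, c, -, hj⟩ := Tree.exists_descend_of_notMem_nodes hwu
      -- If `w` is not internal in `u`, all points below it share one leaf; but 000… and 1000… reach
      -- different leaves of a node.
      have h1 := congrArg Prod.fst ((hj _).symm.trans (key (Stream'.cons false (Stream'.const false))))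
      have h2 := congrArg Prod.fst ((hj _).symm.trans (key (Stream'.cons true (Stream'.const false))))
      have := l.leaves_pos
      simp [Tree.descend_const_false] at h1 h2
      omega
  · intro hv
    by_contra hvt
    obtain ⟨i, c, hi, hc⟩ := Tree.exists_descend_of_notMem_nodes hvt
    obtain ⟨w, hw⟩ := u.exists_address (h ▸ hi)
    refine hv ⟨w ++ c, fun s => u.descend_injective ?_⟩
    rw [hf, hc, Stream'.append_append_stream, hw]

/-- The map determines the internal nodes of the top tree. The bottom tree then follows, because its
descent is that of the top tree composed with the inverse map. -/
theorem eq_of_act_eq {D D' : ThompsonDiagram} (hD : D.Reduced) (hD' : D'.Reduced)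
    (h : ThompsonDiagram.act D = ThompsonDiagram.act D') : D = D' := by
  obtain ⟨t, u, htu, rfl⟩ := exists_eq_treePair hD
  obtain ⟨t', u', htu', rfl⟩ := exists_eq_treePair hD'
  obtain rfl : t = t' := Tree.eq_of_nodes_eq (Finset.ext fun v => by
    rw [mem_nodes_iff hD, mem_nodes_iff hD', h])
  obtain rfl : u = u' := Tree.eq_of_descend_eq (funext fun s => by
    have hs := ThompsonF.act_act_inv (DiagramClass.mk (treePair t u htu)) s
    set r := ThompsonF.act (DiagramClass.mk (treePair t u htu))⁻¹ s
    have hs' : (treePair t u htu).act r = s := hs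
    rw [← hs', descend_act_treePair, h, descend_act_treePair])
  rfl

theorem ThompsonF.act_injective : Function.Injective ThompsonF.act := by
  intro g h hgh
  obtain ⟨D, hD, rfl⟩ := DiagramClass.exists_reduced g
  obtain ⟨E, hE, rfl⟩ := DiagramClass.exists_reduced h
  exact congrArg _ (eq_of_act_eq hD hE hgh)

theorem existsUnique_reduced (g : ThompsonF) :
    ∃! D : ThompsonDiagram, D.Reduced ∧ DiagramClass.mk D = g := by
  obtain ⟨D, hD, rfl⟩ := DiagramClass.exists_reduced g
  exact ⟨D, ⟨hD, rfl⟩, fun E hE => eq_of_act_eq hE.1 hD (congrArg ThompsonF.act hE.2)⟩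

theorem cellLength_mk {D : ThompsonDiagram} (hD : D.Reduced) :
    (DiagramClass.mk D).cellLength = D.cells := by
  have h := Classical.choose_spec (DiagramClass.exists_reduced (DiagramClass.mk D))
  exact congrArg (fun E : ThompsonDiagram => (E.cells : ℝ))
    ((existsUnique_reduced _).unique h ⟨hD, rfl⟩)

/-- Every elimination removes two cells. The bound on the number of cells is what makes the length
subadditive. -/
theorem Diagram.exists_reduced_cells_le {X : Type*} {P : Set (List X × List X)} {u v : List X}
    (D : Diagram P u v) : ∃ E : Diagram P u v, E.Reduced ∧
      DiagramClass.mk E = DiagramClass.mk D ∧ E.cells ≤ D.cells := by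
  induction hn : D.cells using Nat.strong_induction_on generalizing D with
  | _ n ih =>
    by_cases hD : D.Reduced
    · exact ⟨D, hD, rfl, hn.le⟩
    · simp only [Diagram.Reduced, not_forall, not_not] at hD
      obtain ⟨D', h⟩ := hD
      have hc := h.cells_eq
      obtain ⟨E, hE, hE', hE''⟩ := ih D'.cells (by omega) D' rfl
      exact ⟨E, hE, hE'.trans (Quot.sound h).symm, by omega⟩

theorem cellLength_mk_le (D : ThompsonDiagram) : (DiagramClass.mk D).cellLength ≤ D.cells := by
  obtain ⟨E, hE, h, hle⟩ := Diagram.exists_reduced_cells_le D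
  rw [← h, cellLength_mk hE]
  exact_mod_cast hle

theorem isLengthFunction_cellLength :
    IsLengthFunction (fun g : ThompsonF => g.cellLength) where
  nonneg g := Nat.cast_nonneg _
  map_one := le_antisymm ((cellLength_mk_le (Diagram.triv wordX)).trans_eq Nat.cast_zero)
    (Nat.cast_nonneg _)
  map_inv g := by
    obtain ⟨D, hD, rfl⟩ := DiagramClass.exists_reduced g
    have hc : ∀ E : ThompsonDiagram, E.inv.cells = E.cells := fun E => by
      induction E using Quotient.inductionOn with
      | h e => exact e.1.cells_inv
    have hD' : Diagram.Reduced D.inv := fun E h => hD E.inv (by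
      simpa only [Diagram.inv_inv] using h.inv)
    exact (cellLength_mk hD').trans ((congrArg Nat.cast (hc D)).trans (cellLength_mk hD).symm)
  map_mul_le g h := by
    obtain ⟨D, hD, rfl⟩ := DiagramClass.exists_reduced g
    obtain ⟨E, hE, rfl⟩ := DiagramClass.exists_reduced h
    change (DiagramClass.mk (D.comp E)).cellLength ≤ _
    refine (cellLength_mk_le _).trans ?_
    rw [cellLength_mk hD, cellLength_mk hE, Diagram.cells_comp]
    push_cast
    rfl

/-- The length counts the prefixes that are not replaced by a prefix. -/
theorem exists_finset_not_good (g : ThompsonF) : ∃ N : Finset (List Bool),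
    (∀ v, v ∈ N ↔ ¬ Good (ThompsonF.act g) v) ∧ g.cellLength = 2 * N.card := by
  obtain ⟨D, hD, rfl⟩ := DiagramClass.exists_reduced g
  obtain ⟨t, u, h, rfl⟩ := exists_eq_treePair hD
  refine ⟨t.nodes, mem_nodes_iff hD, ?_⟩
  rw [cellLength_mk hD, cells_treePair]
  push_cast
  rfl

/-- Two prefixes of the same stream are comparable. -/
theorem appendStream_eq_cases {α : Type*} : ∀ {u v : List α} {s t : Stream' α},
    u ++ₛ s = v ++ₛ t →
      (∃ c, u = v ++ c ∧ t = c ++ₛ s) ∨ ∃ b c, v = u ++ List.cons b c ∧ s = List.cons b c ++ₛ t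
  | u, [], s, t, h => .inl ⟨u, rfl, h.symm⟩
  | [], List.cons b v, s, t, h => .inr ⟨b, v, rfl, h⟩
  | List.cons a u, List.cons b v, s, t, h => by
    obtain ⟨rfl, h'⟩ := Stream'.cons_injective2 h
    rcases appendStream_eq_cases h' with ⟨c, rfl, hs⟩ | ⟨b, c, rfl, hs⟩
    · exact .inl ⟨c, rfl, hs⟩
    · exact .inr ⟨b, c, rfl, hs⟩

/-- If `f` acts at the address `w` like `f'`, then prefixes behave below `w` as they do
for `f'`. -/
theorem Good.of_append {f f' : Stream' Bool → Stream' Bool} {v w w' : List Bool}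
    (hf : ∀ s, f (w ++ₛ s) = w' ++ₛ f' s) (h : Good f (w ++ v)) : Good f' v := by
  obtain ⟨u, hu⟩ := h
  have key : ∀ s, u ++ₛ s = w' ++ₛ f' (v ++ₛ s) := fun s => by
    rw [← hf, ← hu, Stream'.append_append_stream]
  rcases appendStream_eq_cases (key (Stream'.const false)) with ⟨c, rfl, -⟩ | ⟨b, c, rfl, -⟩
  · refine ⟨c, fun s => ?_⟩
    have := key s
    rw [Stream'.append_append_stream] at this
    exact (Stream'.append_right_injective _ _ _ this).symm
  -- If `u` were a proper prefix of `w'`, then every stream `s` would have to begin with the letter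
  -- `b`.
  · have := key (Stream'.const !b)
    rw [Stream'.append_append_stream] at this
    have := congrArg Stream'.head (Stream'.append_right_injective _ _ _ this)
    rw [Stream'.cons_append_stream, Stream'.const_eq, Stream'.head_cons,
      Stream'.head_cons] at this
    cases b <;> simp at this

theorem Good.append {f : Stream' Bool → Stream' Bool} {v : List Bool} (h : Good f v)
    (c : List Bool) : Good f (v ++ c) := by
  obtain ⟨w, hw⟩ := h
  exact ⟨w ++ c, fun s => by rw [Stream'.append_append_stream, hw, Stream'.append_append_stream]⟩

/-! ### Elements of arbitrarily large length -/

/-- The standard generator of Thompson's group: `00s ↦ 0s`, `01s ↦ 10s`, `1s ↦ 11s`. -/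
def shift : ThompsonF :=
  DiagramClass.mk (treePair (.node (.node .leaf .leaf) .leaf) (.node .leaf (.node .leaf .leaf)) rfl)

theorem descend_act_shift (s : Stream' Bool) :
    (Tree.node .leaf (.node .leaf .leaf)).descend (ThompsonF.act shift s) =
      (Tree.node (.node .leaf .leaf) .leaf).descend s :=
  descend_act_treePair (t := .node (.node .leaf .leaf) .leaf) (u := .node .leaf (.node .leaf .leaf))
    rfl s

theorem act_shift_zero_zero (s : Stream' Bool) :
    ThompsonF.act shift (Stream'.cons false (Stream'.cons false s)) = Stream'.cons false s :=
  Tree.descend_injective _ (descend_act_shift _)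

theorem act_shift_zero_one (s : Stream' Bool) :
    ThompsonF.act shift (Stream'.cons false (Stream'.cons true s)) =
      Stream'.cons true (Stream'.cons false s) :=
  Tree.descend_injective _ (descend_act_shift _)

theorem act_shift_one (s : Stream' Bool) :
    ThompsonF.act shift (Stream'.cons true s) = Stream'.cons true (Stream'.cons true s) :=
  Tree.descend_injective _ (descend_act_shift _)

theorem act_shift_pow_zero (m : ℕ) (s : Stream' Bool) :
    ThompsonF.act (shift ^ m) (List.replicate (m + 1) false ++ₛ s) = Stream'.cons false s := by
  induction m with
  | zero => rfl
  | succ m ih =>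
    rw [pow_succ', ThompsonF.act_mul]
    exact (congrArg _ (act_shift_zero_zero _)).trans ih

theorem act_shift_pow_zero_one (m : ℕ) (s : Stream' Bool) :
    ThompsonF.act (shift ^ (m + 1)) (List.replicate (m + 1) false ++ₛ Stream'.cons true s) =
      Stream'.cons true (Stream'.cons false s) := by
  rw [pow_succ, ThompsonF.act_mul, act_shift_pow_zero, act_shift_zero_one]

/-- Points continuing the prefix by 0 and by 1 have images with different first letters, so the new
prefix would be empty. But 0…01s goes to 10s rather than to 1s. -/
theorem not_good_shift_pow (m : ℕ) :
    ¬ Good (ThompsonF.act (shift ^ (m + 1))) (List.replicate (m + 1) false) := by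
  rintro ⟨w, hw⟩
  have h1 := hw (Stream'.cons true (Stream'.const true))
  have h0 := hw (Stream'.cons false (Stream'.const true))
  rw [act_shift_pow_zero_one] at h1
  have h2 : List.replicate (m + 1) false ++ₛ Stream'.cons false (Stream'.const true) =
      List.replicate (m + 1 + 1) false ++ₛ Stream'.const true := by
    rw [List.replicate_succ' (n := m + 1), Stream'.append_append_stream]
    rfl
  rw [h2, act_shift_pow_zero] at h0
  cases w with
  | nil =>
    have := (Stream'.cons_injective2 h1).2
    rw [Stream'.const_eq] at this
    exact Bool.false_ne_true (Stream'.cons_injective2 this).1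
  | cons b w =>
    have h1 := (Stream'.cons_injective2 h1).1
    have h0 := (Stream'.cons_injective2 h0).1
    exact Bool.false_ne_true (h0.trans h1.symm)

/-- Being replaced by a prefix is inherited by longer addresses, so all prefixes 0^k with k ≤ m
count as well. The resulting bound 2(m + 1) is more than is needed. -/
theorem lt_cellLength_shift_pow (m : ℕ) : (m : ℝ) < (shift ^ (m + 1)).cellLength := by
  obtain ⟨N, hN, h⟩ := exists_finset_not_good (shift ^ (m + 1))
  have hsub : (Finset.range (m + 1)).image (fun k => List.replicate k false) ⊆ N := by
    intro v hv
    obtain ⟨k, hk, rfl⟩ := Finset.mem_image.1 hv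
    refine (hN _).2 fun hg => not_good_shift_pow m ?_
    have := hg.append (List.replicate (m + 1 - k) false)
    rwa [← List.replicate_add, Nat.add_sub_cancel' (Finset.mem_range.1 hk).le] at this
  have hc := Finset.card_le_card hsub
  rw [Finset.card_image_of_injective _ (fun a b hab => by
    simpa using congrArg List.length hab), Finset.card_range] at hc
  have : ((m + 1 : ℕ) : ℝ) ≤ N.card := by exact_mod_cast hc
  push_cast at this
  rw [h]
  linarith

/-! ### Commuting copies of an element below disjoint addresses -/

/-- A copy of an element of Thompson's group that acts below the address `10`. -/
theorem exists_copy (β : ThompsonF) : ∃ b : ThompsonF, b.cellLength ≤ β.cellLength + 4 ∧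
    (∀ s, ThompsonF.act b ([true, false] ++ₛ s) = [true, false] ++ₛ ThompsonF.act β s) ∧
    ∀ x, (∀ s, x ≠ [true, false] ++ₛ s) → ThompsonF.act b x = x := by
  obtain ⟨D, hD, rfl⟩ := DiagramClass.exists_reduced β
  rw [cellLength_mk hD]
  clear hD
  induction D using Quotient.inductionOn with
  | h d =>
    obtain ⟨d, hd, hu, hv⟩ := d
    -- The middle leaf of this tree, with index 1, has address 10. The tree and its inverse account
    -- for the four extra cells.
    set t : Tree := .node .leaf (.node .leaf .leaf)
    let m : Expr Unit := .add (.add (.triv [()]) d) (.triv [()])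
    let e : Expr Unit := .comp (.comp t.expr m) t.expr.inv
    have hm : ∀ p, m.act p = if p.1 = 1 then ((d.act (0, p.2)).1 + 1, (d.act (0, p.2)).2) else p := by
      rintro ⟨i, s⟩
      have hl : (Expr.add (.triv [()]) d).top.length = 2 := by simp [top, hu, wordX]
      rcases Nat.lt_or_ge i 2 with hi | hi
      · rw [act_add_of_lt (d := .add (.triv [()]) d) (hi.trans_eq hl.symm)]
        interval_cases i
        · rfl
        · rfl
      · rw [act_add_of_le (d := .add (.triv [()]) d) (hl.trans_le hi), if_neg (by simp only; omega),
          hl]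
        simp [act, bot, hv, wordX, Nat.sub_add_cancel hi]
    have hd0 : ∀ s, (d.act (0, s)).1 = 0 := fun s => by
      have := act_lt hd (p := (0, s)) (by rw [hu]; exact Nat.one_pos)
      rw [hv] at this
      exact Nat.lt_one_iff.1 this
    have he : e.IsDiagram thompsonCells :=
      ⟨⟨t.isDiagram_expr, ⟨⟨trivial, hd⟩, trivial⟩, unit_list_ext (by simp [m, top, hu]; rfl)⟩,
        isDiagram_inv t.isDiagram_expr, unit_list_ext (by simp [m, bot, hv]; rfl)⟩
    have hinv : ∀ s, t.expr.inv.act (t.descend s) = (0, s) := fun s => by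
      rw [← t.act_expr, act_inv_act t.isDiagram_expr (by simp)]
    have hact : ∀ s, e.act (0, s) = t.expr.inv.act (m.act (t.descend s)) := fun s =>
      congrArg (fun p => t.expr.inv.act (m.act p)) (t.act_expr s)
    refine ⟨DiagramClass.mk (e.toDiagram he t.top_expr (t.expr.bot_inv.trans t.top_expr)),
      ?_, fun s => ?_, fun x hx => ?_⟩
    · refine (cellLength_mk_le _).trans ?_
      have h1 : e.cells = d.cells + 4 := by
        simp [e, m, cells, t, Tree.expr]; omega
      change (e.cells : ℝ) ≤ (d.cells : ℝ) + 4
      rw [h1]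
      push_cast
      rfl
    · change (e.act (0, _)).2 = _ ++ₛ (d.act (0, s)).2
      have h1 : t.descend ([true, false] ++ₛ s) = (1, s) := rfl
      have h2 : (1, (d.act (0, s)).2) = t.descend ([true, false] ++ₛ (d.act (0, s)).2) := rfl
      rw [hact, h1, hm, if_pos rfl, hd0, zero_add, h2, hinv]
    · change (e.act (0, x)).2 = x
      rw [hact, hm, if_neg, hinv]
      obtain ⟨a, x, rfl⟩ : ∃ a t, x = Stream'.cons a t := ⟨_, _, (Stream'.eta x).symm⟩
      obtain ⟨b, x, rfl⟩ : ∃ a t, x = Stream'.cons a t := ⟨_, _, (Stream'.eta x).symm⟩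
      rcases a with _ | _
      · simp [t]
      rcases b with _ | _
      · exact absurd rfl (hx x)
      · simp [t, Tree.leaves]

/-- The addresses `10, 110, 1110, …`, permuted by the generator `shift`. -/
def comb (j : ℕ) : List Bool := List.replicate (j + 1) true ++ [false]

/-- No address `comb j` is a prefix of another one, so the parts of the Cantor set below them are
disjoint. -/
theorem comb_eq_of_append : ∀ {j k : ℕ} {s t : Stream' Bool},
    comb j ++ₛ s = comb k ++ₛ t → j = k
  | 0, 0, _, _, _ => rfl
  | _ + 1, _ + 1, _, _, h =>
    congrArg Nat.succ (comb_eq_of_append (Stream'.cons_injective2 h).2)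
  | 0, _ + 1, _, _, h => absurd
      (Stream'.cons_injective2 (Stream'.cons_injective2 h).2).1 Bool.false_ne_true
  | _ + 1, 0, _, _, h => absurd
      (Stream'.cons_injective2 (Stream'.cons_injective2 h).2).1.symm Bool.false_ne_true

theorem comb_append_ne {j k : ℕ} (h : j ≠ k) (s t : Stream' Bool) :
    comb j ++ₛ s ≠ comb k ++ₛ t := fun h' => h (comb_eq_of_append h')

theorem act_shift_comb (j : ℕ) (s : Stream' Bool) :
    ThompsonF.act shift (comb j ++ₛ s) = comb (j + 1) ++ₛ s := act_shift_one _

/-- Conjugates of a copy of `β` by powers of `shift` are copies of `β` further to the right. -/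
theorem act_conj_shift {b β : ThompsonF}
    (h : ∀ s, ThompsonF.act b (comb 0 ++ₛ s) = comb 0 ++ₛ ThompsonF.act β s)
    (h' : ∀ x, (∀ s, x ≠ comb 0 ++ₛ s) → ThompsonF.act b x = x) (j : ℕ) :
    (∀ s, ThompsonF.act ((shift ^ j)⁻¹ * b * shift ^ j) (comb j ++ₛ s) =
      comb j ++ₛ ThompsonF.act β s) ∧
    ∀ x, (∀ s, x ≠ comb j ++ₛ s) →
      ThompsonF.act ((shift ^ j)⁻¹ * b * shift ^ j) x = x := by
  have hp : ∀ s, ThompsonF.act (shift ^ j) (comb 0 ++ₛ s) = comb j ++ₛ s := by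
    clear h h'
    induction j with
    | zero => exact fun s => rfl
    | succ j ih => intro s; rw [pow_succ, ThompsonF.act_mul, ih, act_shift_comb]
  have hp' : ∀ s, ThompsonF.act (shift ^ j)⁻¹ (comb j ++ₛ s) = comb 0 ++ₛ s := fun s => by
    rw [← hp, ThompsonF.act_inv_act]
  constructor
  · intro s
    rw [ThompsonF.act_mul, ThompsonF.act_mul, hp', h, hp]
  · intro x hx
    rw [ThompsonF.act_mul, ThompsonF.act_mul, h', ThompsonF.act_act_inv]
    intro s hs
    refine hx s ?_
    rw [← hp, ← hs, ThompsonF.act_act_inv]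

/-- Maps with disjoint supports commute, and the action is faithful. -/
theorem commute_of_act {b c β γ : ThompsonF} {j k : ℕ} (hjk : j ≠ k)
    (hb : ∀ s, ThompsonF.act b (comb j ++ₛ s) = comb j ++ₛ ThompsonF.act β s)
    (hb' : ∀ x, (∀ s, x ≠ comb j ++ₛ s) → ThompsonF.act b x = x)
    (hc : ∀ s, ThompsonF.act c (comb k ++ₛ s) = comb k ++ₛ ThompsonF.act γ s)
    (hc' : ∀ x, (∀ s, x ≠ comb k ++ₛ s) → ThompsonF.act c x = x) : Commute b c := by
  refine ThompsonF.act_injective (funext fun x => ?_)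
  rw [ThompsonF.act_mul, ThompsonF.act_mul]
  by_cases hj : ∃ s, x = comb j ++ₛ s
  · obtain ⟨s, rfl⟩ := hj
    rw [hb, hc' _ (comb_append_ne hjk _), hc' _ (comb_append_ne hjk _), hb]
  push Not at hj
  by_cases hk : ∃ s, x = comb k ++ₛ s
  · obtain ⟨s, rfl⟩ := hk
    rw [hb' _ hj, hc, hb' _ (comb_append_ne hjk.symm _)]
  push Not at hk
  rw [hb' _ hj, hc' _ hk, hb' _ hj]

/-- Disjoint copies of elements contribute independently to the length. -/
theorem sum_cellLength_le {ι : Type*} (I : Finset ι) (g : ThompsonF) (β : ι → ThompsonF)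
    (j : ι → ℕ) (hj : Set.InjOn j I) (w : ι → List Bool)
    (h : ∀ i ∈ I, ∀ s, ThompsonF.act g (comb (j i) ++ₛ s) = w i ++ₛ ThompsonF.act (β i) s) :
    ∑ i ∈ I, (β i).cellLength ≤ g.cellLength := by
  classical
  obtain ⟨N, hN, hg⟩ := exists_finset_not_good g
  choose M hM hβ using fun i => exists_finset_not_good (β i)
  have hsub : I.biUnion (fun i => (M i).image (comb (j i) ++ ·)) ⊆ N := by
    intro v hv
    obtain ⟨i, hi, hv⟩ := Finset.mem_biUnion.1 hv
    obtain ⟨v, hv', rfl⟩ := Finset.mem_image.1 hv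
    -- Each address counted for `β i` yields one counted for `g` below `comb (j i)`; disjointness of
    -- these cones makes the counts add up.
    exact (hN _).2 fun hg => (hM i v).1 hv' (hg.of_append (h i hi))
  have hc := Finset.card_le_card hsub
  rw [Finset.card_biUnion] at hc
  · simp_rw [Finset.card_image_of_injective _ (List.append_right_injective _)] at hc
    have hc' : ((∑ i ∈ I, (M i).card : ℕ) : ℝ) ≤ N.card := by exact_mod_cast hc
    push_cast at hc'
    simp_rw [hβ, hg, ← Finset.mul_sum]
    linarith
  · intro a ha b hb hab
    refine Finset.disjoint_left.2 ?_
    intro v hv hv'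
    obtain ⟨u, -, rfl⟩ := Finset.mem_image.1 hv
    obtain ⟨u', -, h'⟩ := Finset.mem_image.1 hv'
    refine hab (hj ha hb (comb_eq_of_append (s := u ++ₛ Stream'.const true)
      (t := u' ++ₛ Stream'.const true) ?_))
    rw [← Stream'.append_append_stream, ← Stream'.append_append_stream]
    exact congrArg (· ++ₛ Stream'.const true) h'.symm

theorem IsLengthFunction.map_pow_le {G : Type*} [Group G] {l : G → ℝ} (hl : IsLengthFunction l)
    (g : G) (n : ℕ) : l (g ^ n) ≤ n * l g := by
  induction n with
  | zero => simp [hl.map_one]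
  | succ n ih =>
    rw [pow_succ]
    have := hl.map_mul_le (g ^ n) g
    push_cast
    linarith

/-! ### Elements that become shorter when raised to a power -/

/-- In the n-th power of the conjugate of `shift` by `b 0 * b n`, the copies of β at `n` cancel and
two copies remain, whereas the conjugate itself contains three. -/
theorem exists_cellLength_pow_lt {n : ℕ} (hn : 1 < n) :
    ∃ g : ThompsonF, (g ^ n).cellLength < g.cellLength := by
  have hl := isLengthFunction_cellLength
  -- The constant is the part of the upper bound for the power that does not involve β; see
  -- `hupper`.
  obtain ⟨m, hm⟩ := exists_nat_gt (5 * n * shift.cellLength + 8)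
  set β := shift ^ (m + 1)
  have hβ : (m : ℝ) < β.cellLength := lt_cellLength_shift_pow m
  obtain ⟨b₀, hb₀, hact, hfix⟩ := exists_copy β
  set b : ℕ → ThompsonF := fun j => (shift ^ j)⁻¹ * b₀ * shift ^ j with hb
  have hba := fun j => (act_conj_shift hact hfix j).1
  have hbf := fun j => (act_conj_shift hact hfix j).2
  have hbi : ∀ j s, ThompsonF.act (b j)⁻¹ (comb j ++ₛ s) = comb j ++ₛ ThompsonF.act β⁻¹ s :=
    fun j s => by
      have h1 := hba j (ThompsonF.act β⁻¹ s)
      rw [ThompsonF.act_act_inv] at h1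
      rw [← h1, ThompsonF.act_inv_act]
  have hbif : ∀ j k, j ≠ k → ∀ s, ThompsonF.act (b k)⁻¹ (comb j ++ₛ s) = comb j ++ₛ s :=
    fun j k hjk s => by
      conv_lhs => rw [← hbf k _ (comb_append_ne hjk s)]
      exact ThompsonF.act_inv_act _ _
  have hbfix : ∀ j k, j ≠ k → ∀ s, ThompsonF.act (b k) (comb j ++ₛ s) = comb j ++ₛ s :=
    fun j k hjk s => hbf k _ (comb_append_ne hjk s)
  have hcomm : Commute (b 0) (b n) :=
    commute_of_act (by omega) (hba 0) (hbf 0) (hba n) (hbf n)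
  have hlen : ∀ j : ℕ, (b j).cellLength ≤ 2 * j * shift.cellLength + β.cellLength + 4 := by
    intro j
    have h1 := hl.map_mul_le ((shift ^ j)⁻¹ * b₀) (shift ^ j)
    have h2 := hl.map_mul_le (shift ^ j)⁻¹ b₀
    have h3 := hl.map_inv (shift ^ j)
    have h4 := IsLengthFunction.map_pow_le hl shift j
    simp only [hb]
    linarith
  refine ⟨(b 0 * b n)⁻¹ * shift * (b 0 * b n), ?_⟩
  have hpow : ((b 0 * b n)⁻¹ * shift * (b 0 * b n)) ^ n = shift ^ n * (b (2 * n))⁻¹ * b 0 := by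
    have h1 : ((b 0 * b n)⁻¹ * shift * (b 0 * b n)) ^ n =
        (b 0 * b n)⁻¹ * shift ^ n * (b 0 * b n) := by
      simpa using conj_pow (a := (b 0 * b n)⁻¹) (b := shift) (i := n)
    -- Moving `shift ^ n` to the left raises the index of each copy by `n`.
    have h2 : (b 0 * b n)⁻¹ * shift ^ n = shift ^ n * (b n * b (2 * n))⁻¹ := by
      simp only [hb, two_mul, pow_add, pow_zero]
      group
    rw [h1, h2, hcomm.eq]
    group
  have hupper : (shift ^ n * (b (2 * n))⁻¹ * b 0).cellLength ≤
      5 * n * shift.cellLength + 2 * β.cellLength + 8 := by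
    have h1 := hl.map_mul_le (shift ^ n * (b (2 * n))⁻¹) (b 0)
    have h2 := hl.map_mul_le (shift ^ n) (b (2 * n))⁻¹
    have h3 := hl.map_inv (b (2 * n))
    have h4 := IsLengthFunction.map_pow_le hl shift n
    have h5 := hlen 0
    have h6 := hlen (2 * n)
    push_cast at h5 h6
    linarith
  -- β⁻¹ is applied below addresses 0 and n before the shift, and β below address n after it, that
  -- is, to points coming from n - 1. The three starting addresses are distinct because n > 1. The
  -- copy `b 0` contributes no fourth term: nothing below a comb address is shifted to `comb 0`.
  have hlower := sum_cellLength_le Finset.univ ((b 0 * b n)⁻¹ * shift * (b 0 * b n))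
    ![β⁻¹, β⁻¹, β] ![0, n, n - 1] (by
      intro i _ k _ h
      fin_cases i <;> fin_cases k <;> simp at h ⊢ <;> omega)
    ![comb 1, comb (n + 1), comb n] (by
      intro i _ s
      have hsub : n - 1 + 1 = n := by omega
      fin_cases i
      · simp only [Fin.zero_eta, Matrix.cons_val_zero, mul_inv_rev, ThompsonF.act_mul]
        rw [hbif 0 n (by omega), hbi, act_shift_comb, hbfix 1 0 (by omega),
          hbfix 1 n (by omega)]
      · simp only [Fin.mk_one, Matrix.cons_val_one, Matrix.cons_val_zero, mul_inv_rev,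
          ThompsonF.act_mul]
        rw [hbi, hbif n 0 (by omega), act_shift_comb, hbfix (n + 1) 0 (by omega),
          hbfix (n + 1) n (by omega)]
      · simp only [Fin.reduceFinMk, Matrix.cons_val, mul_inv_rev, ThompsonF.act_mul]
        rw [hbif (n - 1) n (by omega), hbif (n - 1) 0 (by omega), act_shift_comb, hsub,
          hbfix n 0 (by omega), hba])
  have hinv := hl.map_inv β
  simp only [Fin.sum_univ_three, Matrix.cons_val_zero, Matrix.cons_val_one, Matrix.cons_val,
    hinv] at hlower
  rw [hpow]
  linarith

/-- The value r = 1 already fails. Exponents 0 and 1 are refuted by `shift`, larger ones by an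
element whose power is shorter. -/
theorem not_universallyMonotone_cellLength :
    ¬ UniversallyMonotone (fun g : ThompsonF => g.cellLength) := by
  intro h
  obtain ⟨K, hK⟩ := h 1
  have hl := isLengthFunction_cellLength
  have hpos : (0 : ℝ) < shift.cellLength := by simpa using lt_cellLength_shift_pow 0
  have hne : ∀ g : ThompsonF, 0 < g.cellLength → g ≠ 1 := by
    rintro g hg rfl
    exact hg.ne' hl.map_one
  obtain ⟨g, hg, hlt⟩ : ∃ g : ThompsonF, 0 < g.cellLength ∧
      (g ^ K).cellLength < g.cellLength + 1 := by
    match K with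
    | 0 => exact ⟨shift, hpos, by rw [pow_zero, hl.map_one]; linarith⟩
    | 1 => exact ⟨shift, hpos, by rw [pow_one]; linarith⟩
    | K + 2 =>
      obtain ⟨g, hg⟩ := exists_cellLength_pow_lt (n := K + 2) (by omega)
      exact ⟨g, (hl.nonneg _).trans_lt hg, by linarith⟩
  exact (hK g (hne g hg)).not_gt hlt

end DiagramGroup

theorem mainTheorem7 :
    (∀ g : DiagramGroup.ThompsonF,
      ∃! D : DiagramGroup.ThompsonDiagram, D.Reduced ∧ DiagramGroup.DiagramClass.mk D = g) ∧
    IsLengthFunction (fun g : DiagramGroup.ThompsonF => g.cellLength) ∧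
    ¬ UniversallyMonotone (fun g : DiagramGroup.ThompsonF => g.cellLength) ∧
    ∀ n : ℕ, 1 < n → ∃ D : DiagramGroup.ThompsonDiagram, D.Reduced ∧
      (DiagramGroup.DiagramClass.mk D ^ n).cellLength < (DiagramGroup.DiagramClass.mk D).cellLength := by
  refine ⟨DiagramGroup.existsUnique_reduced, DiagramGroup.isLengthFunction_cellLength,
    DiagramGroup.not_universallyMonotone_cellLength, fun n hn => ?_⟩
  obtain ⟨g, hg⟩ := DiagramGroup.exists_cellLength_pow_lt hn
  obtain ⟨D, hD, rfl⟩ := DiagramGroup.DiagramClass.exists_reduced g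
  exact ⟨D, hD, hg⟩
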